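/- All posets are finite, with strict order $\prec$; $a\parallel b$ means that $a$ and $b$ are incomparable. An interval representation of a poset $P=(X,\prec)$ assigns to each $x\in X$ a closed real interval $I_x$ such that $x\prec y$ if and only if $I_x$ lies completely to the left of $I_y$; $|I_x|$ is the length of $I_x$, and $P$ is an interval order if it has an interval representation. For $f:X\to[0,\infty)$ and $\epsilon>0$, let $G(P,f)$ be the weighted digraph with vertex set $X$ that has an arc $(a,b)$ of weight $-f(b)-\epsilon$ whenever $a\succ b$, arcs $(a,b)$ of weight $f(a)$ and $(b,a)$ of weight $f(b)$ whenever $a\ne b$ and $a\parallel b$, and no other arcs. A cycle is a nonempty cyclic sequence of distinct vertices in which consecutive vertices are joined by arcs; its weight is the sum of the weights of its arcs, and it is negative if its weight is negative. A weighted poset $(Q,g)$ is induced in $(P,f)$ if it is isomorphic to the restriction of $(P,f)$ to some subset of $X$. Let $\mathcal F$ be the set of the following weighted posets. (i) The poset $\mathbf{3+1}$ with points $a,y,b,x$, whose only comparabilities are $b\prec y$, $y\prec a$, $b\prec a$, with weights in $\{1,2\}$ such that $f(y)=2$ or $f(x)=1$. (ii) For each integer $t\ge 0$, the members of four families $\mathcal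 F_1,\dots,\mathcal F_4$. Their points are $x_1,\dots,x_{t+1}$, $y_0,\dots,y_{t+1}$, $a$, $b$, and in $\mathcal F_3,\mathcal F_4$ also $x_0$. In $\mathcal F_2$ and $\mathcal F_4$, $a$ is the point $y_{t+1}$; in $\mathcal F_1$ and $\mathcal F_3$, it is a further point. The order is the transitive closure of the relations $b\prec y_0$, $y_i\prec y_{i+1}$, $x_i\prec x_{i+2}$, $x_i\prec y_{i+1}$, $y_i\prec x_{i+2}$ (for all $i\ge 0$ for which both points exist), together with $y_{t+1}\prec a$ in $\mathcal F_1$ and $\mathcal F_3$, and $b\prec x_1$ in $\mathcal F_3$ and $\mathcal F_4$. The weights $f(a)$ and $f(b)$ are each 1 or 2, arbitrarily. Of the remaining points, those of weight 1 are $y_0,y_{t+1}$ in $\mathcal F_1$; $y_0,x_{t+1}$ in $\mathcal F_2$; $x_0,y_{t+1}$ in $\mathcal F_3$; $x_0,x_{t+1}$ in $\mathcal F_4$; all others have weight 2. **Theorem.** Let $P=(X,\prec)$ be an interval order, let $f:X\to\{1,2\}$ be a weight function, and let $0<\epsilon<1/|X|^2$ (any $\epsilon>0$ if $X=\emptyset$)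 be the constant in $G(P,f)$. The following are equivalent: 1. $P$ has an interval representation in which $|I_x|=f(x)$ for all $x\in X$. 2. $G(P,f)$ has no negative cycle. 3. No weighted poset in $\mathcal F$ is induced in $(P,f)$. -/

import Mathlib

open scoped NNReal

namespace WeightedIntervalOrder

/-! ### Interval representations -/

/-- `I` is an interval representation of the poset `X`: every point gets a nonempty closed real
interval, and `x < y` iff the interval of `x` lies completely to the left of that of `y`. -/
def IsIntervalRepresentation {X : Type*} [PartialOrder X] (I : X → NonemptyInterval ℝ) : Prop :=
  ∀ x y : X, x < y ↔ ∀ s ∈ I x, ∀ t ∈ I y, s < t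

/-- An interval order is a poset that has an interval representation. -/
def IsIntervalOrder (X : Type*) [PartialOrder X] : Prop :=
  ∃ I : X → NonemptyInterval ℝ, IsIntervalRepresentation I

/-! ### Weighted digraphs and cycles -/

/-- A digraph with a real weight on each arc (the value of `wgt` off the arcs is irrelevant). -/
structure WeightedDigraph (V : Type*) extends Digraph V where
  wgt : V → V → ℝ

/-- A cycle: a nonempty cyclic sequence `v 0, …, v n` of distinct vertices such that each
`(v i, v (i + 1))` and also `(v n, v 0)` is an arc. Addition in `Fin (n + 1)` is modulo `n + 1`. -/
structure WeightedDigraph.Cycle {V : Type*} (G : WeightedDigraph V) where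
  n : ℕ
  v : Fin (n + 1) → V
  distinct : Function.Injective v
  arc : ∀ i, G.Adj (v i) (v (i + 1))

/-- The weight of a cycle is the sum of the weights of its arcs. -/
def WeightedDigraph.Cycle.weight {V : Type*} {G : WeightedDigraph V} (C : G.Cycle) : ℝ :=
  ∑ i, G.wgt (C.v i) (C.v (i + 1))

open Classical in
/-- The weighted digraph `G(P, f)` with parameter `ε`. If `a > b`, there is an arc `(a, b)` of
weight `-f b - ε`; if `a` and `b` are distinct and incomparable, there are arcs `(a, b)` of weight
`f a` and `(b, a)` of weight `f b`. There are no other arcs. -/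
noncomputable def digraphG {X : Type*} [PartialOrder X] (f : X → ℝ≥0) (ε : ℝ) :
    WeightedDigraph X where
  Adj a b := b < a ∨ IncompRel (· ≤ ·) a b
  wgt a b := if b < a then -(f b : ℝ) - ε else (f a : ℝ)

/-! ### Weighted posets and the forbidden set -/

/-- A poset with a nonnegative real weight on each point. -/
structure WeightedPoset where
  carrier : Type
  order : PartialOrder carrier
  weight : carrier → ℝ≥0

attribute [instance] WeightedPoset.order

/-- `Q` is induced in `(X, f)`: some set of points of `X`, with the restricted order and weights,
is isomorphic to `Q`. -/
def WeightedPoset.IsInducedIn (Q : WeightedPoset) {X : Type*} [PartialOrder X]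
    (f : X → ℝ≥0) : Prop :=
  ∃ φ : Q.carrier ↪o X, ∀ p, f (φ p) = Q.weight p

/-- The poset `3 + 1`: the chain `inl 0 < inl 1 < inl 2` and the point `inr 0`, incomparable to
the chain, with weights `w`. -/
def threePlusOne (w : Fin 3 ⊕ Fin 1 → ℝ≥0) : WeightedPoset where
  carrier := Fin 3 ⊕ Fin 1
  order := inferInstance
  weight := w

/-- The indices of the four infinite families. -/
inductive Family
  | F1 | F2 | F3 | F4

/-- Names of points. -/
inductive Label
  | a | b
  | x (i : ℕ)
  | y (i : ℕ)

open Family Label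

/-- In the families 2 and 4 the point `a` is `y (t + 1)`; in 1 and 3 it is a further point. -/
def Family.top : Family → ℕ → Label
  | F1, _ => a
  | F2, t => y (t + 1)
  | F3, _ => a
  | F4, t => y (t + 1)

/-- The point `x 0` exists in the families 3 and 4 only. -/
def Family.HasX0 : Family → Prop
  | F1 => False
  | F2 => False
  | F3 => True
  | F4 => True

/-- The points of the member with parameter `t`: `b`, `a`, `x 1, …, x (t + 1)`,
`y 0, …, y (t + 1)`, and possibly `x 0`. -/
def Family.points (j : Family) (t : ℕ) : Set Label :=
  {p | p = b ∨ p = j.top t ∨ (∃ i, 1 ≤ i ∧ i ≤ t + 1 ∧ p = x i) ∨ (∃ i, i ≤ t + 1 ∧ p = y i) ∨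
    (j.HasX0 ∧ p = x 0)}

/-- The listed comparabilities, which generate the order by transitivity. -/
inductive Family.Gen (j : Family) (t : ℕ) : Label → Label → Prop
  | b_y : Gen j t b (y 0)
  | y_y (i : ℕ) : Gen j t (y i) (y (i + 1))
  | x_x (i : ℕ) : Gen j t (x i) (x (i + 2))
  | x_y (i : ℕ) : Gen j t (x i) (y (i + 1))
  | y_x (i : ℕ) : Gen j t (y i) (x (i + 2))
  | y_a : j = F1 ∨ j = F3 → Gen j t (y (t + 1)) a
  | b_x : j = F3 ∨ j = F4 → Gen j t b (x 1)

/-- The strict order on the points: the transitive closure of the listed comparabilities. -/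
def Family.Lt (j : Family) (t : ℕ) : j.points t → j.points t → Prop :=
  Relation.TransGen fun p q => j.Gen t p q

/-- A height function, used only to see that `Family.Lt` is irreflexive. -/
def Label.height (t : ℕ) : Label → ℕ
  | a => t + 3
  | b => 0
  | x i => i + 1
  | y i => i + 1

theorem Family.Lt.height_lt {j : Family} {t : ℕ} {p q : j.points t} (h : j.Lt t p q) :
    p.1.height t < q.1.height t := by
  have key : ∀ p q : Label, j.Gen t p q → p.height t < q.height t := by
    intro p q h
    cases h <;> simp [Label.height]
  induction h with
  | single h => exact key _ _ h
  | tail _ h ih => exact ih.trans (key _ _ h)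

instance (j : Family) (t : ℕ) : IsStrictOrder (j.points t) (j.Lt t) where
  irrefl _ h := lt_irrefl _ (Family.Lt.height_lt h)
  trans _ _ _ h₁ h₂ := Relation.TransGen.trans h₁ h₂

/-- The points, other than `a` and `b`, that have weight 1. -/
def Family.ones : Family → ℕ → Set Label
  | F1, t => {y 0, y (t + 1)}
  | F2, t => {y 0, x (t + 1)}
  | F3, t => {x 0, y (t + 1)}
  | F4, t => {x 0, x (t + 1)}

open Classical in
/-- The member of the `j`-th family with parameter `t` and `f(a) = wa`, `f(b) = wb`. -/
noncomputable def Family.member (j : Family) (t : ℕ) (wa wb : ℝ≥0) : WeightedPoset where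
  carrier := j.points t
  order := partialOrderOfSO (j.Lt t)
  weight p :=
    if p.1 = j.top t then wa
    else if p.1 = b then wb
    else if p.1 ∈ j.ones t then 1
    else 2

/-- The set of forbidden weighted posets: the poset `3 + 1` with weights in `{1, 2}` such that the
middle of the chain has weight 2 or the isolated point has weight 1, and all members of the four
families, where `a` and `b` have weights in `{1, 2}`. -/
def forbidden : Set WeightedPoset :=
  {Q | ∃ w : Fin 3 ⊕ Fin 1 → ℝ≥0, (∀ p, w p = 1 ∨ w p = 2) ∧
      (w (Sum.inl 1) = 2 ∨ w (Sum.inr 0) = 1) ∧ Q = threePlusOne w} ∪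
  {Q | ∃ (j : Family) (t : ℕ) (wa wb : ℝ≥0), (wa = 1 ∨ wa = 2) ∧ (wb = 1 ∨ wb = 2) ∧
      Q = j.member t wa wb}

end WeightedIntervalOrder

/-!
A representation with lengths `f` is the same as a potential of the digraph `G(P, f)`, namely the
left endpoints, up to the slack `ε`. A potential exists as soon as no cycle is negative
(`WeightedDigraph.exists_potential`), and since `ε` is small and the weights are integers, a
negative cycle rules out a representation (`not_exists_negative_cycle`). That the forbidden posets
have no representation is a direct estimate along the two strands of points `x i` and `y i`
(`Family.member_not_isInducedIn`).

The remaining step extracts a forbidden poset from a negative cycle. Place the endpoints of all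
points on a line so that distinct positions of the same kind are separated by the order
(`EndpointOrder`). A negative cycle becomes a closed walk on this line whose moves go up along an
interval, at cost `f`, or down along an interval, at cost `-f`; between two moves the walk properly
descends; the total cost is at most `0` (`exists_closed_walk_of_negative_cycle`).

Consider a shortest walk of this kind. If the end of one of its descents lies below the start of
another one, then the part of the walk from the former to the latter can be closed up, and by
minimality its cost is positive. Hence the descents are pairwise disjoint, and a higher descent is
reached from a lower one at positive cost. If the total cost is negative, this leaves only walks of
length `2`, that is, two nested intervals, which give a poset `3 + 1`. If it is `0`, every descent
has a well-defined level, and the levels are distinct and ordered as the positions of the descents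
are (`src_lt_tgt_iff_of_minimal`). So the levels form a cycle of distinct integers with steps of
size `1` or `2`. Unless it has length `2`, such a cycle ascends through one parity class and
descends through the other (`IsLevelCycle.exists_parity`). As the levels determine all
comparabilities between the intervals used, the walk spells out a member of one of the four
families (`Zigzag.member_isInducedIn`): the family is determined by the parity class that ascends
and the parity of the number of levels, and the points `a` and `b` are witnesses for the descents
at the highest and the lowest level.
-/

namespace WeightedIntervalOrder

/-! ### Potentials of weighted digraphs -/

namespace WeightedDigraph

variable {V : Type*} {G : WeightedDigraph V}

/-- A stretch of a walk that returns to its first vertex and is otherwise injective is a cycle. -/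
theorem exists_cycle_of_walk (s : ℕ → V) (i m : ℕ)
    (hs : ∀ k ≤ m, G.Adj (s (i + k)) (s (i + k + 1)))
    (hinj : ∀ k ≤ m, ∀ l ≤ m, s (i + k) = s (i + l) → k = l) (hclose : s (i + m + 1) = s i) :
    ∃ C : G.Cycle,
      C.weight = ∑ k ∈ Finset.range (m + 1), G.wgt (s (i + k)) (s (i + k + 1)) := by
  have hsucc : ∀ k : Fin (m + 1), s (i + (k + 1 : Fin (m + 1)).val) = s (i + k.val + 1) := by
    intro k
    rw [Fin.val_add_one]
    split_ifs with h
    · subst h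
      simpa using hclose.symm
    · rfl
  refine ⟨⟨m, fun k => s (i + k.val), ?_, ?_⟩, ?_⟩
  · intro k l h
    exact Fin.ext (hinj k (by omega) l (by omega) h)
  · intro k
    show G.Adj _ (s (i + (k + 1 : Fin (m + 1)).val))
    rw [hsucc]
    exact hs k (by omega)
  · rw [← Fin.sum_univ_eq_sum_range (fun k => G.wgt (s (i + k)) (s (i + k + 1)))]
    refine Finset.sum_congr rfl fun k _ => ?_
    show G.wgt _ (s (i + (k + 1 : Fin (m + 1)).val)) = _
    rw [hsucc]

/-- A walk that visits some vertex twice contains a cycle. -/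
theorem exists_simple_return (s : ℕ → V) (n : ℕ) (h : ∃ i j, i < j ∧ j ≤ n ∧ s i = s j) :
    ∃ i m, i + m + 1 ≤ n ∧ s (i + m + 1) = s i ∧
      ∀ k ≤ m, ∀ l ≤ m, s (i + k) = s (i + l) → k = l := by
  classical
  have hex : ∃ m, ∃ i, i + m + 1 ≤ n ∧ s (i + m + 1) = s i := by
    obtain ⟨i, j, hij, hj, h⟩ := h
    refine ⟨j - i - 1, i, by omega, ?_⟩
    rw [h]
    congr 1
    omega
  obtain ⟨i, hi, hs⟩ := Nat.find_spec hex
  have aux : ∀ k ≤ Nat.find hex, ∀ l ≤ Nat.find hex, k < l → s (i + k) ≠ s (i + l) := by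
    intro k hk l hl hkl h
    refine Nat.find_min hex (m := l - k - 1) (by omega) ⟨i + k, by omega, ?_⟩
    rw [h]
    congr 1
    omega
  refine ⟨i, _, hi, hs, fun k hk l hl h => ?_⟩
  rcases lt_trichotomy k l with hkl | hkl | hkl
  · exact absurd h (aux k hk l hl hkl)
  · exact hkl
  · exact absurd h.symm (aux l hl k hk hkl)

/-- Without negative cycles the costs of all walks are bounded below: cutting out cycles does not
raise the cost, and walks without cycles have fewer arcs than there are vertices. -/
theorem neg_card_mul_le_sum_wgt [Fintype V] (hG : ∀ C : G.Cycle, 0 ≤ C.weight) {B : ℝ}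
    (hB : 0 ≤ B) (hw : ∀ a b, -B ≤ G.wgt a b) :
    ∀ (n : ℕ) (s : ℕ → V), (∀ k < n, G.Adj (s k) (s (k + 1))) →
      -(Fintype.card V * B) ≤ ∑ k ∈ Finset.range n, G.wgt (s k) (s (k + 1)) := by
  intro n
  induction n using Nat.strong_induction_on with
  | _ n ih =>
    intro s hs
    by_cases h : ∃ i j, i < j ∧ j ≤ n ∧ s i = s j
    · obtain ⟨i, m, him, hret, hinj⟩ := exists_simple_return s n h
      obtain ⟨r, rfl⟩ := Nat.exists_eq_add_of_le him
      obtain ⟨C, hC⟩ := exists_cycle_of_walk (G := G) s i m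
        (fun k hk => hs (i + k) (by omega)) hinj hret
      let s' : ℕ → V := fun k => if k ≤ i then s k else s (k + (m + 1))
      have h1 : ∀ k < i, s' k = s k ∧ s' (k + 1) = s (k + 1) := by
        intro k hk
        constructor <;> simp only [s'] <;> rw [if_pos (by omega)]
      have h2 : ∀ k, s' (i + k) = s (i + m + 1 + k) ∧
          s' (i + k + 1) = s (i + m + 1 + k + 1) := by
        intro k
        constructor
        · rcases Nat.eq_zero_or_pos k with rfl | hk
          · simp [s', hret]
          · simp only [s']
            rw [if_neg (by omega)]
            congr 1
            omega
        · simp only [s']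
          rw [if_neg (by omega)]
          congr 1
          omega
      have hs' := ih (i + r) (by omega) s' (by
        intro k hk
        rcases lt_or_ge k i with hki | hki
        · rw [(h1 k hki).1, (h1 k hki).2]
          exact hs k (by omega)
        · obtain ⟨l, rfl⟩ := Nat.exists_eq_add_of_le hki
          rw [(h2 l).1, (h2 l).2]
          exact hs _ (by omega))
      have hsum : ∑ k ∈ Finset.range (i + r), G.wgt (s' k) (s' (k + 1)) + C.weight =
          ∑ k ∈ Finset.range (i + m + 1 + r), G.wgt (s k) (s (k + 1)) := by
        have hsplit : ∑ k ∈ Finset.range (i + m + 1), G.wgt (s k) (s (k + 1)) =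
            ∑ k ∈ Finset.range i, G.wgt (s k) (s (k + 1)) +
              ∑ k ∈ Finset.range (m + 1), G.wgt (s (i + k)) (s (i + k + 1)) :=
          Finset.sum_range_add _ i (m + 1)
        rw [hC, Finset.sum_range_add _ i r, Finset.sum_range_add _ (i + m + 1) r, hsplit,
          Finset.sum_congr rfl fun k hk => by
            rw [(h1 k (Finset.mem_range.1 hk)).1, (h1 k (Finset.mem_range.1 hk)).2],
          Finset.sum_congr (s₁ := Finset.range r) rfl fun k _ => by
            rw [(h2 k).1, (h2 k).2]]
        ring
      linarith [hG C]
    · have hinj : Function.Injective fun k : Fin (n + 1) => s k := by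
        intro k l hkl
        by_contra hne
        rcases lt_or_gt_of_ne hne with hlt | hlt
        · exact h ⟨k, l, hlt, by omega, hkl⟩
        · exact h ⟨l, k, hlt, by omega, hkl.symm⟩
      have hcard : n ≤ Fintype.card V := by
        have := Fintype.card_le_of_injective _ hinj
        rw [Fintype.card_fin] at this
        omega
      have hsum : ∑ _k ∈ Finset.range n, -B ≤
          ∑ k ∈ Finset.range n, G.wgt (s k) (s (k + 1)) :=
        Finset.sum_le_sum fun k _ => hw _ _
      rw [Finset.sum_const, Finset.card_range, nsmul_eq_mul] at hsum
      have : (n : ℝ) * B ≤ Fintype.card V * B := by gcongr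
      linarith

/-- A finite weighted digraph without negative cycles has a potential: the infimum of the costs of
the walks that end at a given vertex. -/
theorem exists_potential [Fintype V] (hG : ∀ C : G.Cycle, 0 ≤ C.weight) :
    ∃ p : V → ℝ, ∀ a b, G.Adj a b → p b ≤ p a + G.wgt a b := by
  classical
  obtain ⟨B, hB, hw⟩ : ∃ B : ℝ, 0 ≤ B ∧ ∀ a b, -B ≤ G.wgt a b := by
    refine ⟨∑ e : V × V, |G.wgt e.1 e.2|, Finset.sum_nonneg fun _ _ => abs_nonneg _, ?_⟩
    intro a b
    have : |G.wgt a b| ≤ ∑ e : V × V, |G.wgt e.1 e.2| :=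
      Finset.single_le_sum (f := fun e : V × V => |G.wgt e.1 e.2|)
        (fun _ _ => abs_nonneg _) (Finset.mem_univ (a, b))
    linarith [neg_abs_le (G.wgt a b)]
  let S : V → Set ℝ := fun x => {c | ∃ (n : ℕ) (s : ℕ → V),
    (∀ k < n, G.Adj (s k) (s (k + 1))) ∧ s n = x ∧
      c = ∑ k ∈ Finset.range n, G.wgt (s k) (s (k + 1))}
  have hne : ∀ x, (S x).Nonempty := fun x => ⟨0, 0, fun _ => x, by simp, rfl, by simp⟩
  have hbdd : ∀ x, BddBelow (S x) := by
    rintro x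
    refine ⟨-(Fintype.card V * B), ?_⟩
    rintro _ ⟨n, s, hs, -, rfl⟩
    exact neg_card_mul_le_sum_wgt hG hB hw n s hs
  refine ⟨fun x => sInf (S x), fun a b hab => ?_⟩
  rw [← sub_le_iff_le_add]
  refine le_csInf (hne a) ?_
  rintro _ ⟨n, s, hs, rfl, rfl⟩
  rw [sub_le_iff_le_add]
  refine csInf_le (hbdd b) ⟨n + 1, fun k => if k ≤ n then s k else b, ?_, ?_, ?_⟩
  · intro k hk
    rcases lt_or_ge k n with hkn | hkn
    · simpa [show k ≤ n by omega, show k + 1 ≤ n by omega] using hs k hkn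
    · obtain rfl : k = n := by omega
      simpa using hab
  · simp
  · rw [Finset.sum_range_succ]
    congr 1
    · refine Finset.sum_congr rfl fun k hk => ?_
      have := Finset.mem_range.1 hk
      simp [show k ≤ n by omega, show k + 1 ≤ n by omega]
    · simp

end WeightedDigraph

/-! ### Representations with prescribed lengths and negative cycles -/

section Representation

variable {X : Type*} [PartialOrder X]

theorem IsIntervalRepresentation.lt_iff {I : X → NonemptyInterval ℝ}
    (hI : IsIntervalRepresentation I) {x y : X} : x < y ↔ (I x).snd < (I y).fst := by
  rw [hI x y]
  constructor
  · intro h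
    exact h _ ⟨(I x).fst_le_snd, le_rfl⟩ _ ⟨le_rfl, (I y).fst_le_snd⟩
  · rintro h s ⟨-, hs⟩ t ⟨ht, -⟩
    exact hs.trans_lt (h.trans_le ht)

theorem exists_representation_of_potential {f : X → ℝ≥0} {ε : ℝ} (hε : 0 < ε) {p : X → ℝ}
    (hp : ∀ a b, (digraphG f ε).Adj a b → p b ≤ p a + (digraphG f ε).wgt a b) :
    ∃ I : X → NonemptyInterval ℝ, IsIntervalRepresentation I ∧ ∀ x, (I x).length = (f x : ℝ) := by
  have hf : ∀ x, (0 : ℝ) ≤ f x := fun x => (f x).2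
  refine ⟨fun x => ⟨(p x, p x + f x), by simp⟩, fun x y => ?_, fun x => ?_⟩
  · have key : x < y ↔ p x + f x < p y := by
      constructor
      · intro h
        have := hp y x (Or.inl h)
        simp only [digraphG, if_pos h] at this
        linarith
      · intro h
        by_contra hxy
        by_cases hyx : y < x
        · have := hp x y (Or.inl hyx)
          simp only [digraphG, if_pos hyx] at this
          linarith [hf x, hf y]
        · rcases eq_or_ne x y with rfl | hne
          · linarith [hf x]
          · have := hp x y (Or.inr ⟨fun h => hxy (h.lt_of_ne hne),
              fun h => hyx (h.lt_of_ne hne.symm)⟩)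
            simp only [digraphG, if_neg hyx] at this
            linarith
    rw [key]
    constructor
    · rintro h s ⟨-, hs⟩ t ⟨ht, -⟩
      exact hs.trans_lt (h.trans_le ht)
    · intro h
      exact h _ ⟨by simp, le_rfl⟩ _ ⟨le_rfl, by simp⟩
  · simp [NonemptyInterval.length]

variable {f : X → ℝ≥0} {g : X → ℤ} {ε : ℝ}

open Classical in
/-- The integral part of the weight of the arc `(a, b)` of `digraphG f ε`, for integral weights
`g` on the points. -/
noncomputable def arcInt (g : X → ℤ) (a b : X) : ℤ := if b < a then -g b else g a

/-- A cycle has at most `card X` vertices, so the contributions of `ε` to its weight add up to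
less than `1`; they vanish only if there is no descending arc. -/
theorem exists_weight_eq [Fintype X] (hg : ∀ x, (f x : ℝ) = g x) (hε : 0 < ε)
    (hε' : ε * (Fintype.card X : ℝ) ^ 2 < 1) (C : (digraphG f ε).Cycle) :
    ∃ δ : ℝ, 0 ≤ δ ∧ δ < 1 ∧ C.weight = (∑ i, arcInt g (C.v i) (C.v (i + 1)) : ℤ) - δ ∧
      ((∃ i, C.v (i + 1) < C.v i) ↔ 0 < δ) := by
  classical
  refine ⟨∑ i, if C.v (i + 1) < C.v i then ε else 0, ?_, ?_, ?_, ?_⟩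
  · exact Finset.sum_nonneg fun i _ => by split_ifs <;> simp [hε.le]
  · have hle : ∑ i, (if C.v (i + 1) < C.v i then ε else 0) ≤ ∑ _i : Fin (C.n + 1), ε :=
      Finset.sum_le_sum fun i _ => by split_ifs <;> simp [hε.le]
    rw [Finset.sum_const, Finset.card_univ, nsmul_eq_mul] at hle
    have hcard : (Fintype.card (Fin (C.n + 1)) : ℝ) ≤ Fintype.card X := by
      exact_mod_cast Fintype.card_le_of_injective _ C.distinct
    have h1 : (1 : ℝ) ≤ Fintype.card X := by
      refine le_trans ?_ hcard
      rw [Fintype.card_fin]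
      push_cast
      linarith [(Nat.cast_nonneg C.n : (0 : ℝ) ≤ C.n)]
    have h2 : (Fintype.card X : ℝ) ≤ (Fintype.card X : ℝ) ^ 2 := by nlinarith
    nlinarith
  · rw [WeightedDigraph.Cycle.weight, Int.cast_sum, ← Finset.sum_sub_distrib]
    refine Finset.sum_congr rfl fun i _ => ?_
    simp only [digraphG, arcInt]
    split_ifs <;> simp [hg]
  · constructor
    · rintro ⟨i, hi⟩
      exact Finset.sum_pos' (fun i _ => by split_ifs <;> simp [hε.le])
        ⟨i, Finset.mem_univ _, by simpa [hi] using hε⟩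
    · intro h
      by_contra hcon
      push Not at hcon
      simp [hcon] at h

/-- A representation bounds the integral part of the weight of an arc from below by the difference
of the left endpoints, strictly for descending arcs; these differences cancel along a cycle. -/
theorem not_exists_negative_cycle [Fintype X] (hg : ∀ x, (f x : ℝ) = g x) (hε : 0 < ε)
    (hε' : ε * (Fintype.card X : ℝ) ^ 2 < 1) {I : X → NonemptyInterval ℝ}
    (hI : IsIntervalRepresentation I) (hlen : ∀ x, (I x).length = (f x : ℝ)) :
    ¬ ∃ C : (digraphG f ε).Cycle, C.weight < 0 := by
  rintro ⟨C, hC⟩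
  obtain ⟨δ, hδ0, hδ1, hw, hδ⟩ := exists_weight_eq hg hε hε' C
  have hR : ∀ x, (I x).snd = (I x).fst + g x := by
    intro x
    have := hlen x
    rw [NonemptyInterval.length, hg] at this
    linarith
  have htel : ∑ i, ((I (C.v (i + 1))).fst - (I (C.v i)).fst) = 0 := by
    rw [Finset.sum_sub_distrib, sub_eq_zero]
    exact Equiv.sum_comp (Equiv.addRight 1) fun i => (I (C.v i)).fst
  have hstep : ∀ i, (I (C.v (i + 1))).fst - (I (C.v i)).fst ≤
      (arcInt g (C.v i) (C.v (i + 1)) : ℝ) ∧ (C.v (i + 1) < C.v i →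
        (I (C.v (i + 1))).fst - (I (C.v i)).fst < (arcInt g (C.v i) (C.v (i + 1)) : ℝ)) := by
    intro i
    by_cases h : C.v (i + 1) < C.v i
    · have h1 := hI.lt_iff.1 h
      rw [hR] at h1
      simp only [arcInt, if_pos h, Int.cast_neg]
      exact ⟨by linarith, fun _ => by linarith⟩
    · have h1 : ¬ C.v i < C.v (i + 1) := by
        rcases C.arc i with h2 | h2
        · exact absurd h2 h
        · exact fun h3 => h2.1 h3.le
      rw [hI.lt_iff, not_lt, hR] at h1
      simp only [arcInt, if_neg h]
      exact ⟨by linarith, fun h2 => absurd h2 h⟩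
  have hsum : (0 : ℝ) ≤ (∑ i, arcInt g (C.v i) (C.v (i + 1)) : ℤ) := by
    rw [Int.cast_sum, ← htel]
    exact Finset.sum_le_sum fun i _ => (hstep i).1
  by_cases hd : ∃ i, C.v (i + 1) < C.v i
  · have hpos : (0 : ℝ) < (∑ i, arcInt g (C.v i) (C.v (i + 1)) : ℤ) := by
      rw [Int.cast_sum, ← htel]
      obtain ⟨i, hi⟩ := hd
      exact Finset.sum_lt_sum (fun i _ => (hstep i).1) ⟨i, Finset.mem_univ _, (hstep i).2 hi⟩
    have h1 : (1 : ℝ) ≤ (∑ i, arcInt g (C.v i) (C.v (i + 1)) : ℤ) := by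
      exact_mod_cast hpos
    linarith
  · have : δ = 0 := le_antisymm (not_lt.1 fun h => hd (hδ.2 h)) hδ0
    linarith

end Representation

/-! ### The order of the forbidden posets -/

namespace Family

open Label

/-- An explicit description of the strict order on the points of the forbidden posets. -/
def Below (j : Family) (t : ℕ) : Label → Label → Prop
  | b, y _ => True
  | b, x k => 2 ≤ k ∨ k = 1 ∧ j.HasX0
  | b, a => True
  | y i, y k => i < k
  | y i, x k => i + 2 ≤ k
  | y _, a => True
  | x i, y k => i + 1 ≤ k
  | x i, x k => i + 2 ≤ k
  | x i, a => i ≤ t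
  | _, _ => False

variable {j : Family} {t : ℕ}

theorem b_mem_points : b ∈ j.points t := Or.inl rfl

theorem y_mem_points_iff {i : ℕ} : y i ∈ j.points t ↔ i ≤ t + 1 := by
  cases j <;> simp [points, top, HasX0] <;> omega

theorem x_mem_points_iff {i : ℕ} : x i ∈ j.points t ↔ i ≤ t + 1 ∧ (i = 0 → j.HasX0) := by
  rcases Nat.eq_zero_or_pos i with rfl | hi
  · cases j <;> simp [points, top, HasX0]
  · cases j <;> simp [points, top, HasX0] <;> omega

theorem a_mem_points_iff : a ∈ j.points t ↔ j.top t = a := by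
  cases j <;> simp [points, top, HasX0]

theorem Gen.below {p q : Label} (h : j.Gen t p q) : j.Below t p q := by
  cases h with
  | b_x h => rcases h with rfl | rfl <;> simp [Below, HasX0]
  | _ => simp [Below]

theorem Below.trans_gen {p q r : Label} (h : j.Below t p q) (h' : j.Gen t q r) :
    j.Below t p r := by
  cases h' <;> cases p <;> simp only [Below] at h ⊢ <;> omega

theorem Lt.below {p q : j.points t} (h : j.Lt t p q) : j.Below t p q := by
  induction h with
  | single h => exact Gen.below h
  | tail _ h ih => exact ih.trans_gen h

theorem lt_of_gen {p q : Label} (hp : p ∈ j.points t) (hq : q ∈ j.points t) (h : j.Gen t p q) :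
    j.Lt t ⟨p, hp⟩ ⟨q, hq⟩ :=
  Relation.TransGen.single h

/-- A point `p` below `y i` is below every later point `y k`. -/
theorem lt_y_of_le {p : j.points t} {i k : ℕ} (hi : y i ∈ j.points t) (hk : y k ∈ j.points t)
    (hik : i ≤ k) (h : j.Lt t p ⟨y i, hi⟩) : j.Lt t p ⟨y k, hk⟩ := by
  induction k, hik using Nat.le_induction with
  | base => exact h
  | succ k hik ih =>
    have hk' : y k ∈ j.points t := y_mem_points_iff.2 (by have := y_mem_points_iff.1 hk; omega)
    exact (ih hk').tail (Gen.y_y k)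

theorem lt_x_of_lt_y {p : j.points t} {i k : ℕ} (hi : y i ∈ j.points t) (hk : x k ∈ j.points t)
    (hik : i + 2 ≤ k) (h : j.Lt t p ⟨y i, hi⟩) : j.Lt t p ⟨x k, hk⟩ := by
  obtain ⟨k, rfl⟩ : ∃ l, k = l + 2 := ⟨k - 2, by omega⟩
  have hk' : y k ∈ j.points t := y_mem_points_iff.2 (by have := (x_mem_points_iff.1 hk).1; omega)
  exact (lt_y_of_le hi hk' (by omega) h).tail (Gen.y_x k)

theorem lt_a_of_lt_y {p : j.points t} {i : ℕ} (hi : y i ∈ j.points t) (ha : a ∈ j.points t)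
    (h : j.Lt t p ⟨y i, hi⟩) : j.Lt t p ⟨a, ha⟩ := by
  have hj : j = F1 ∨ j = F3 := by
    have := a_mem_points_iff.1 ha
    cases j <;> simp_all [top]
  exact (lt_y_of_le hi (y_mem_points_iff.2 le_rfl) (y_mem_points_iff.1 hi) h).tail (Gen.y_a hj)

theorem Below.lt {p q : Label} (hp : p ∈ j.points t) (hq : q ∈ j.points t)
    (h : j.Below t p q) : j.Lt t ⟨p, hp⟩ ⟨q, hq⟩ := by
  have hy : ∀ i, i ≤ t + 1 → y i ∈ j.points t := fun i hi => y_mem_points_iff.2 hi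
  have hb : ∀ hp : b ∈ j.points t, j.Lt t ⟨b, hp⟩ ⟨y 0, hy 0 (by omega)⟩ :=
    fun hp => lt_of_gen _ _ Gen.b_y
  have hyy : ∀ i (hi : y i ∈ j.points t) (hi' : i + 1 ≤ t + 1),
      j.Lt t ⟨y i, hi⟩ ⟨y (i + 1), hy _ hi'⟩ := fun i _ _ => lt_of_gen _ _ (Gen.y_y i)
  have hxy : ∀ i (hi : x i ∈ j.points t) (hi' : i + 1 ≤ t + 1),
      j.Lt t ⟨x i, hi⟩ ⟨y (i + 1), hy _ hi'⟩ := fun i _ _ => lt_of_gen _ _ (Gen.x_y i)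
  have hj : a ∈ j.points t → j = F1 ∨ j = F3 := by
    intro ha
    have := a_mem_points_iff.1 ha
    cases j <;> simp_all [top]
  cases p <;> cases q <;> simp only [Below] at h
  case b.a => exact lt_a_of_lt_y _ hq (hb hp)
  case b.x k =>
    rcases h with h | ⟨rfl, h⟩
    · exact lt_x_of_lt_y _ hq (by omega) (hb hp)
    · refine lt_of_gen _ _ (Gen.b_x ?_)
      cases j <;> simp_all [HasX0]
  case b.y k => exact lt_y_of_le _ hq (by omega) (hb hp)
  case x.a i => exact lt_a_of_lt_y _ hq (hxy i hp (by omega))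
  case x.x i k =>
    have hk := (x_mem_points_iff.1 hq).1
    rcases h.eq_or_lt with rfl | h
    · exact lt_of_gen _ _ (Gen.x_x i)
    · exact lt_x_of_lt_y _ hq (by omega) (hxy i hp (by omega))
  case x.y i k =>
    have hk := y_mem_points_iff.1 hq
    exact lt_y_of_le _ hq h (hxy i hp (by omega))
  case y.a i =>
    have hi := y_mem_points_iff.1 hp
    rcases hi.eq_or_lt with rfl | hi
    · exact lt_of_gen _ _ (Gen.y_a (hj hq))
    · exact lt_a_of_lt_y _ hq (hyy i hp (by omega))
  case y.x i k =>
    have hk := (x_mem_points_iff.1 hq).1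
    rcases h.eq_or_lt with rfl | h
    · exact lt_of_gen _ _ (Gen.y_x i)
    · exact lt_x_of_lt_y _ hq (by omega) (hyy i hp (by omega))
  case y.y i k =>
    have hk := y_mem_points_iff.1 hq
    exact lt_y_of_le _ hq h (hyy i hp (by omega))

theorem lt_iff_below {p q : j.points t} : j.Lt t p q ↔ j.Below t p q :=
  ⟨Lt.below, Below.lt p.2 q.2⟩

/-- Distinct points are separated by the order: the points other than the `x i` form a chain, and
every `x i` is incomparable to two consecutive members of that chain. -/
theorem eq_of_below_iff {p q : Label} (hp : p ∈ j.points t) (hq : q ∈ j.points t)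
    (h : ∀ r ∈ j.points t, (j.Below t p r ↔ j.Below t q r) ∧ (j.Below t r p ↔ j.Below t r q)) :
    p = q := by
  have hy : ∀ i, i ≤ t + 1 → y i ∈ j.points t := fun i hi => y_mem_points_iff.2 hi
  have hb := h b b_mem_points
  have h0 := h (y 0) (hy 0 (by omega))
  have hpp := h p hp
  have hqq := h q hq
  -- an `x i` is separated from a member of the chain by `y i` or by the predecessor of `y i`
  have hx : ∀ i, x i ∈ j.points t → ∀ r, r ∈ j.points t → (∀ k, r ≠ x k) →
      ¬ ∀ s ∈ j.points t, (j.Below t (x i) s ↔ j.Below t r s) ∧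
        (j.Below t s (x i) ↔ j.Below t s r) := by
    intro i hi r hr hne hs
    have hi' := x_mem_points_iff.1 hi
    have h1 := hs (y i) (hy i hi'.1)
    have h2 := hs b b_mem_points
    cases r with
    | a => simp [Below] at h1
    | b => simp [Below] at h1
    | x k => exact hne k rfl
    | y k =>
      rcases Nat.eq_zero_or_pos i with rfl | hpos
      · simp [Below] at h2
      · have h3 := hs (y (i - 1)) (hy _ (by omega))
        simp only [Below] at h1 h3
        omega
  cases p with
  | x i =>
    by_cases hqx : ∃ k, q = x k
    · obtain ⟨k, rfl⟩ := hqx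
      have hi := (x_mem_points_iff.1 hp).1
      have hk := (x_mem_points_iff.1 hq).1
      by_contra hne
      have hne' : i ≠ k := fun h => hne (by rw [h])
      rcases lt_or_gt_of_ne hne' with hlt | hlt
      · have := h (y (i + 1)) (hy _ (by omega))
        simp only [Below] at this
        omega
      · have := h (y (k + 1)) (hy _ (by omega))
        simp only [Below] at this
        omega
    · exact absurd h (hx i hp q hq fun k hk => hqx ⟨k, hk⟩)
  | a =>
    cases q with
    | x k =>
      refine absurd (fun s hs => ⟨(h s hs).1.symm, (h s hs).2.symm⟩) (hx k hq a hp (by simp))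
    | _ => simp_all [Below]
  | b =>
    cases q with
    | x k =>
      refine absurd (fun s hs => ⟨(h s hs).1.symm, (h s hs).2.symm⟩) (hx k hq b hp (by simp))
    | _ => simp_all [Below]
  | y i =>
    cases q with
    | x k =>
      refine absurd (fun s hs => ⟨(h s hs).1.symm, (h s hs).2.symm⟩) (hx k hq (y i) hp (by simp))
    | y k =>
      simp only [Below] at hpp hqq
      congr 1
      omega
    | _ => simp_all [Below]

end Family

section Induced

variable {X : Type*} [PartialOrder X] {f : X → ℝ≥0}

open Family Label

/-- A labelling of points of `X` that respects weights and order exhibits an induced member of one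
of the four families. -/
theorem Family.member_isInducedIn {j : Family} {t : ℕ} {wa wb : ℝ≥0} (e : Label → X)
    (hgen : ∀ p ∈ j.points t, ∀ q ∈ j.points t, j.Gen t p q → e p < e q)
    (hbelow : ∀ p ∈ j.points t, ∀ q ∈ j.points t, e p < e q → j.Below t p q)
    (hw : ∀ p : (j.member t wa wb).carrier, f (e p.1) = (j.member t wa wb).weight p) :
    (j.member t wa wb).IsInducedIn f := by
  have hlt : ∀ p q : j.points t, e p.1 < e q.1 ↔ j.Lt t p q := by
    intro p q
    refine ⟨fun h => (hbelow _ p.2 _ q.2 h).lt p.2 q.2, fun h => ?_⟩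
    induction h with
    | single h => exact hgen _ p.2 _ (Subtype.property _) h
    | tail _ h ih => exact ih.trans (hgen _ (Subtype.property _) _ (Subtype.property _) h)
  have hinj : ∀ p q : j.points t, e p.1 = e q.1 → p = q := by
    intro p q h
    refine Subtype.ext (eq_of_below_iff p.2 q.2 fun r hr => ?_)
    have h1 := hlt p ⟨r, hr⟩
    have h2 := hlt ⟨r, hr⟩ p
    rw [h] at h1 h2
    rw [hlt q ⟨r, hr⟩, lt_iff_below, lt_iff_below] at h1
    rw [hlt ⟨r, hr⟩ q, lt_iff_below, lt_iff_below] at h2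
    exact ⟨h1.symm, h2.symm⟩
  refine ⟨⟨⟨fun p => e p.1, fun p q h => hinj p q h⟩, ?_⟩, hw⟩
  intro p q
  show e p.1 ≤ e q.1 ↔ p = q ∨ j.Lt t p q
  rw [le_iff_eq_or_lt, hlt p q]
  exact or_congr_left ⟨hinj p q, fun h => by rw [h]⟩

theorem threePlusOne_isInducedIn {x y a b : X} (hby : b < y) (hya : y < a) (hbx : ¬ b < x)
    (hxa : ¬ x < a) :
    (threePlusOne (Sum.elim ![f b, f y, f a] fun _ => f x)).IsInducedIn f := by
  have hba := hby.trans hya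
  have hbx' : b ≠ x := fun h => hxa (h ▸ hba)
  have hxa' : x ≠ a := fun h => hbx (h ▸ hba)
  have h1 : ∀ i : Fin 3, ¬ ![b, y, a] i ≤ x ∧ ¬ x ≤ ![b, y, a] i := by
    intro i
    fin_cases i
    · exact ⟨fun h => hbx (h.lt_of_ne hbx'), fun h => hxa (h.trans_lt hba)⟩
    · exact ⟨fun h => hbx (hby.trans_le h), fun h => hxa (h.trans_lt hya)⟩
    · exact ⟨fun h => hbx (hba.trans_le h), fun h => hxa (h.lt_of_ne hxa')⟩
  have h2 : StrictMono ![b, y, a] := by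
    rw [Fin.strictMono_iff_lt_succ]
    intro i
    fin_cases i
    · exact hby
    · exact hya
  let e : Fin 3 ⊕ Fin 1 → X := Sum.elim ![b, y, a] fun _ => x
  have he : ∀ p q : Fin 3 ⊕ Fin 1, e p ≤ e q ↔ p ≤ q := by
    rintro (i | i) (k | k)
    · simpa [e] using h2.le_iff_le
    · simpa [e] using (h1 i).1
    · simpa [e] using (h1 k).2
    · simp [e, Subsingleton.elim i k]
  refine ⟨OrderEmbedding.ofMapLEIff e he, ?_⟩
  rintro (i | i)
  · fin_cases i <;> rfl
  · rfl

/-- In a representation of a member of one of the families, the intervals of `y 0, …, y t` and of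
`x 1, …, x (t + 1)` drift apart: `y i` ends more than `1` to the right of the left endpoint of
`x (i + 1)`. At the upper end this leaves no room for `a`. -/
theorem Family.member_not_isInducedIn {I : X → NonemptyInterval ℝ}
    (hI : IsIntervalRepresentation I) (hlen : ∀ x, (I x).length = (f x : ℝ))
    (j : Family) (t : ℕ) (wa wb : ℝ≥0) : ¬ (j.member t wa wb).IsInducedIn f := by
  classical
  rintro ⟨φ, hφ⟩
  let φ' : j.points t → X := φ
  have hlt : ∀ p q : j.points t, φ' p < φ' q ↔ j.Below t p q := by
    intro p q
    rw [← lt_iff_below]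
    have h : φ' p ≤ φ' q ↔ p = q ∨ j.Lt t p q := φ.le_iff_le
    have h' : φ' p = φ' q ↔ p = q := φ.injective.eq_iff
    rw [lt_iff_le_and_ne, h, Ne, h']
    constructor
    · rintro ⟨h | h, hne⟩
      · exact absurd h hne
      · exact h
    · intro h
      refine ⟨Or.inr h, ?_⟩
      rintro rfl
      exact lt_irrefl _ h.height_lt
  let l : Label → ℝ := fun p => if hp : p ∈ j.points t then (I (φ' ⟨p, hp⟩)).fst else 0
  let w : Label → ℝ := fun p => if hp : p ∈ j.points t then
    ((j.member t wa wb).weight ⟨p, hp⟩ : ℝ) else 0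
  have hl : ∀ p ∈ j.points t, ∀ q ∈ j.points t, l p + w p < l q ↔ j.Below t p q := by
    intro p hp q hq
    rw [← hlt ⟨p, hp⟩ ⟨q, hq⟩, hI.lt_iff]
    have h1 := hlen (φ' ⟨p, hp⟩)
    rw [show f (φ' ⟨p, hp⟩) = _ from hφ ⟨p, hp⟩, NonemptyInterval.length] at h1
    simp only [l, w, dif_pos hp, dif_pos hq, ← h1]
    rw [add_sub_cancel]
  have hw : ∀ p ∈ j.points t, w p = if p = j.top t then (wa : ℝ) else if p = b then (wb : ℝ) else
      if p ∈ j.ones t then 1 else 2 := by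
    intro p hp
    simp only [w, dif_pos hp, Family.member]
    split_ifs <;> rfl
  have hy : ∀ i ≤ t + 1, y i ∈ j.points t := fun i hi => y_mem_points_iff.2 hi
  have hx : ∀ i, 1 ≤ i → i ≤ t + 1 → x i ∈ j.points t := fun i h1 h2 =>
    x_mem_points_iff.2 ⟨h2, by omega⟩
  have hb : b ∈ j.points t := b_mem_points
  have base : l (x 1) + 1 < l (y 0) + w (y 0) := by
    have h1 := (hl b hb (y 0) (hy 0 (by omega))).2 trivial
    by_cases hj : j.HasX0
    · have hx0 : x 0 ∈ j.points t := x_mem_points_iff.2 ⟨by omega, fun _ => hj⟩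
      have h2 := (hl b hb (x 0) hx0).not.2 (by simp [Below])
      have h3 := (hl (x 0) hx0 (x 1) (hx 1 le_rfl (by omega))).not.2 (by simp [Below])
      have h4 := hw _ (hy 0 (by omega))
      have h5 := hw _ hx0
      have h6 : w (y 0) = 2 := by rw [h4]; cases j <;> simp_all [HasX0, top, ones]
      have h7 : w (x 0) = 1 := by rw [h5]; cases j <;> simp_all [HasX0, top, ones]
      linarith
    · have h2 := (hl b hb (x 1) (hx 1 le_rfl (by omega))).not.2 (by simp [Below, hj])
      have h4 := hw _ (hy 0 (by omega))
      have h6 : w (y 0) = 1 := by rw [h4]; cases j <;> simp_all [HasX0, top, ones]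
      linarith
  have step : ∀ i ≤ t, l (x (i + 1)) + 1 < l (y i) + w (y i) := by
    intro i
    induction i with
    | zero => exact fun _ => base
    | succ i ih =>
      intro hi
      have h0 := ih (by omega)
      have h1 := (hl (y i) (hy _ (by omega)) (y (i + 1)) (hy _ (by omega))).2 (by simp [Below])
      have h2 := (hl (x (i + 1)) (hx _ (by omega) (by omega)) (x (i + 1 + 1))
        (hx _ (by omega) (by omega))).not.2 (by simp [Below])
      have h3 : w (y (i + 1)) = 2 := by
        rw [hw _ (hy _ (by omega))]
        cases j <;> simp [top, ones] <;> omega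
      have h4 : w (x (i + 1)) = 2 := by
        rw [hw _ (hx _ (by omega) (by omega))]
        cases j <;> simp [top, ones] <;> omega
      linarith
  have h0 := step t le_rfl
  have h1 := (hl (y t) (hy _ (by omega)) (y (t + 1)) (hy _ le_rfl)).2 (by simp [Below])
  have hxt := hx (t + 1) (by omega) le_rfl
  by_cases hj : j.top t = a
  · have ha : a ∈ j.points t := a_mem_points_iff.2 hj
    have h2 := (hl (y (t + 1)) (hy _ le_rfl) a ha).2 trivial
    have h3 := (hl (x (t + 1)) hxt a ha).not.2 (by simp [Below])
    have h4 : w (y (t + 1)) = 1 := by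
      rw [hw _ (hy _ le_rfl)]
      cases j <;> simp_all [top, ones]
    have h5 : w (x (t + 1)) = 2 := by
      rw [hw _ hxt]
      cases j <;> simp_all [top, ones]
    linarith
  · have h3 := (hl (x (t + 1)) hxt (y (t + 1)) (hy _ le_rfl)).not.2 (by simp [Below])
    have h4 : w (x (t + 1)) = 1 := by
      rw [hw _ hxt]
      cases j <;> simp_all [top, ones]
    linarith

theorem threePlusOne_not_isInducedIn {I : X → NonemptyInterval ℝ}
    (hI : IsIntervalRepresentation I) (hlen : ∀ x, (I x).length = (f x : ℝ))
    {w : Fin 3 ⊕ Fin 1 → ℝ≥0} (hle : w (Sum.inr 0) ≤ w (Sum.inl 1)) :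
    ¬ (threePlusOne w).IsInducedIn f := by
  rintro ⟨φ, hφ⟩
  let φ' : Fin 3 ⊕ Fin 1 ↪o X := φ
  have hφ' : ∀ p, f (φ' p) = w p := hφ
  have h1 : φ' (Sum.inl 0) < φ' (Sum.inl 1) := φ'.lt_iff_lt.2 (by simp)
  have h2 : φ' (Sum.inl 1) < φ' (Sum.inl 2) := φ'.lt_iff_lt.2 (by simp)
  have h3 : ¬ φ' (Sum.inl 0) < φ' (Sum.inr 0) := fun h => by simpa using φ'.lt_iff_lt.1 h
  have h4 : ¬ φ' (Sum.inr 0) < φ' (Sum.inl 2) := fun h => by simpa using φ'.lt_iff_lt.1 h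
  rw [hI.lt_iff] at h1 h2 h3 h4
  have h5 := hlen (φ' (Sum.inl 1))
  have h6 := hlen (φ' (Sum.inr 0))
  rw [hφ', NonemptyInterval.length] at h5 h6
  have h7 : (w (Sum.inr 0) : ℝ) ≤ w (Sum.inl 1) := by exact_mod_cast hle
  linarith

theorem not_isInducedIn_of_representation {I : X → NonemptyInterval ℝ}
    (hI : IsIntervalRepresentation I) (hlen : ∀ x, (I x).length = (f x : ℝ)) :
    ∀ Q ∈ forbidden, ¬ Q.IsInducedIn f := by
  rintro Q (⟨w, hw, h, rfl⟩ | ⟨j, t, wa, wb, -, -, rfl⟩)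
  · refine threePlusOne_not_isInducedIn hI hlen ?_
    have h12 : (1 : ℝ≥0) ≤ 2 := by norm_num
    rcases hw (Sum.inl 1) with h1 | h1 <;> rcases hw (Sum.inr 0) with h2 | h2 <;>
      simp_all
  · exact j.member_not_isInducedIn hI hlen t wa wb

end Induced

/-! ### Endpoints of an interval order -/

/-- Positions of the left and right endpoints of the points of an interval order in a linear order,
with no superfluous distinctions: any two right endpoints at different positions are separated by
a left endpoint, and any two left endpoints by a right endpoint. -/
structure EndpointOrder (X K : Type*) [PartialOrder X] [LinearOrder K] where
  left : X → K
  right : X → K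
  left_ne_right : ∀ x y, left x ≠ right y
  lt_iff : ∀ x y, x < y ↔ right x < left y
  exists_above : ∀ x y, right y < right x → ∃ a, y < a ∧ ¬ x < a
  exists_below : ∀ x y, left y < left x → ∃ b, b < x ∧ ¬ b < y

section EndpointOrder

variable {X : Type*} [PartialOrder X]

/-- Starting from any representation, move every right endpoint down to the largest left endpoint
that is not to its right, then every left endpoint up to the smallest new right endpoint that is
not to its left. In the lexicographic product left endpoints precede the right endpoints with the
same coordinate. -/
theorem IsIntervalOrder.nonempty_endpointOrder [Finite X] (hP : IsIntervalOrder X) :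
    Nonempty (EndpointOrder X (ℝ ×ₗ Bool)) := by
  classical
  have := Fintype.ofFinite X
  obtain ⟨I, hI⟩ := hP
  have hA : ∀ x : X, ∃ a, ¬ x < a ∧ ∀ a', ¬ x < a' → (I a').fst ≤ (I a).fst := by
    intro x
    obtain ⟨a, ha, hmax⟩ := Finset.exists_max_image {a | ¬ x < a} (fun a => (I a).fst)
      ⟨x, by simp⟩
    exact ⟨a, by simpa using ha, fun a' ha' => hmax a' (by simpa using ha')⟩
  choose A hA hAmax using hA
  have hr : ∀ x y, x < y ↔ (I (A x)).fst < (I y).fst := by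
    intro x y
    refine ⟨fun h => lt_of_le_of_lt ?_ (hI.lt_iff.1 h), fun h => ?_⟩
    · exact not_lt.1 fun h' => hA x (hI.lt_iff.2 h')
    · by_contra hxy
      exact absurd (hAmax x y hxy) (not_le.2 h)
  have hB : ∀ y : X, ∃ b, ¬ b < y ∧ ∀ b', ¬ b' < y → (I (A b)).fst ≤ (I (A b')).fst := by
    intro y
    obtain ⟨b, hb, hmin⟩ := Finset.exists_min_image {b | ¬ b < y} (fun b => (I (A b)).fst)
      ⟨y, by simp⟩
    exact ⟨b, by simpa using hb, fun b' hb' => hmin b' (by simpa using hb')⟩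
  choose B hB hBmin using hB
  have hl : ∀ x y, x < y ↔ (I (A x)).fst < (I (A (B y))).fst := by
    intro x y
    refine ⟨fun h => ((hr x y).1 h).trans_le ?_, fun h => ?_⟩
    · exact not_lt.1 fun h' => hB y ((hr _ _).2 h')
    · by_contra hxy
      exact absurd (hBmin y x hxy) (not_le.2 h)
  refine ⟨⟨fun x => toLex ((I (A (B x))).fst, false), fun x => toLex ((I (A x)).fst, true),
    ?_, ?_, ?_, ?_⟩⟩
  · intro x y h
    simpa using congrArg (fun p => (ofLex p).2) h
  · intro x y
    rw [hl, Prod.Lex.toLex_lt_toLex]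
    simp
  · intro x y h
    rw [Prod.Lex.toLex_lt_toLex] at h
    exact ⟨A x, (hr _ _).2 (by simpa using h), hA x⟩
  · intro x y h
    rw [Prod.Lex.toLex_lt_toLex] at h
    exact ⟨B y, (hl _ _).2 (by simpa using h), hB y⟩

theorem EndpointOrder.left_lt_right {K : Type*} [LinearOrder K] (E : EndpointOrder X K) (x : X) :
    E.left x < E.right x :=
  lt_of_le_of_ne (not_lt.1 fun h => lt_irrefl x ((E.lt_iff x x).2 h)) (E.left_ne_right x x)

end EndpointOrder

/-! ### Closed walks of moves along intervals -/

/-- A move along the interval of a point, either from the left endpoint up to the right endpoint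
or back down. -/
inductive Move (X : Type*)
  | up (x : X)
  | down (x : X)

namespace Move

variable {X : Type*}

/-- The signed length of a move. -/
def cost (g : X → ℤ) : Move X → ℤ
  | up x => g x
  | down x => -g x

/-- The reverse move. -/
def inv : Move X → Move X
  | up x => down x
  | down x => up x

theorem inv_inv (s : Move X) : s.inv.inv = s := by cases s <;> rfl

theorem cost_inv (g : X → ℤ) (s : Move X) : cost g s.inv = -cost g s := by
  cases s <;> simp [inv, cost]

variable {K : Type*} [PartialOrder X] [LinearOrder K]

/-- The endpoint at which a move starts. -/
def src (E : EndpointOrder X K) : Move X → K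
  | up x => E.left x
  | down x => E.right x

/-- The endpoint at which a move stops. -/
def tgt (E : EndpointOrder X K) : Move X → K
  | up x => E.right x
  | down x => E.left x

theorem tgt_inv (E : EndpointOrder X K) (s : Move X) : tgt E s.inv = src E s := by
  cases s <;> rfl

/-- The move `t` can follow the move `s` if a proper descent leads from the end of `s` to the
start of `t`. -/
def Follows (E : EndpointOrder X K) (s t : Move X) : Prop := src E t < tgt E s

end Move

/-- A closed walk of length `n` for the relation `T`, encoded as a sequence with period `n`. -/
structure IsClosedWalk {α : Type*} (T : α → α → Prop) (n : ℕ) (s : ℕ → α) : Prop where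
  pos : 0 < n
  periodic : ∀ k, s (k + n) = s k
  rel : ∀ k, T (s k) (s (k + 1))

namespace IsClosedWalk

variable {α : Type*} {T : α → α → Prop} {n : ℕ} {s : ℕ → α}

/-- A finite sequence whose last term is related to its first gives a closed walk. -/
theorem of_segment (hn : 0 < n) (hs : ∀ k, k + 1 < n → T (s k) (s (k + 1)))
    (hclose : T (s (n - 1)) (s 0)) : IsClosedWalk T n fun k => s (k % n) := by
  refine ⟨hn, fun k => by simp, fun k => ?_⟩
  have hk := Nat.mod_lt k hn
  rcases Nat.lt_or_ge (k % n + 1) n with h | h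
  · have : (k + 1) % n = k % n + 1 := by
      rw [Nat.add_mod, Nat.mod_eq_of_lt (show 1 < n by omega), Nat.mod_eq_of_lt h]
    simp only [this]
    exact hs _ h
  · have h1 : k % n = n - 1 := by omega
    have h2 : (k + 1) % n = 0 := by
      rw [← Nat.mod_add_mod, h1, Nat.sub_add_cancel hn, Nat.mod_self]
    simp only [h1, h2]
    exact hclose

theorem sum_segment (s : ℕ → α) (w : α → ℤ) (n : ℕ) :
    ∑ k ∈ Finset.range n, w (s (k % n)) = ∑ k ∈ Finset.range n, w (s k) :=
  Finset.sum_congr rfl fun k hk => by rw [Nat.mod_eq_of_lt (Finset.mem_range.1 hk)]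

theorem map_mod (h : IsClosedWalk T n s) (k : ℕ) : s (k % n) = s k :=
  Function.Periodic.map_mod_nat h.periodic k

theorem shift (h : IsClosedWalk T n s) (i : ℕ) : IsClosedWalk T n fun k => s (i + k) :=
  ⟨h.pos, fun k => by rw [← add_assoc, h.periodic], fun k => h.rel (i + k)⟩

theorem sum_shift (h : IsClosedWalk T n s) (w : α → ℤ) (i : ℕ) :
    ∑ k ∈ Finset.range n, w (s (i + k)) = ∑ k ∈ Finset.range n, w (s k) := by
  induction i with
  | zero => simp
  | succ i ih =>
    rw [← ih]
    have h1 := Finset.sum_range_succ (fun k => w (s (i + k))) n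
    have h2 := Finset.sum_range_succ' (fun k => w (s (i + k))) n
    rw [h1] at h2
    simp only [h.periodic, add_zero] at h2
    have h3 : ∀ k, i + 1 + k = i + (k + 1) := fun k => by ring
    simp only [h3]
    linarith

end IsClosedWalk

section Walks

variable {X K : Type*} [PartialOrder X] [LinearOrder K] {E : EndpointOrder X K} {g : X → ℤ}

open Move

/-- Moves that are immediately reversed can be deleted from a closed walk, without changing its
cost, as long as the walk makes some proper descent. -/
theorem exists_closed_walk_of_reversals : ∀ (n : ℕ) (s : ℕ → Move X),
    IsClosedWalk (fun p q => Follows E p q ∨ q = p.inv) n s →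
    ∑ k ∈ Finset.range n, cost g (s k) ≤ 0 → (∃ k, Follows E (s k) (s (k + 1))) →
    ∃ n s, IsClosedWalk (Follows E) n s ∧ ∑ k ∈ Finset.range n, cost g (s k) ≤ 0 := by
  intro n
  induction n using Nat.strong_induction_on with
  | _ n ih =>
    intro s hs hcost hex
    by_cases hall : ∀ k, Follows E (s k) (s (k + 1))
    · exact ⟨n, s, ⟨hs.pos, hs.periodic, hall⟩, hcost⟩
    -- rotate the walk so that it starts with a move and its reverse
    push Not at hall
    obtain ⟨i, hi⟩ := hall
    let u : ℕ → Move X := fun k => s (i + k)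
    have hu : IsClosedWalk (fun p q => Follows E p q ∨ q = p.inv) n u := hs.shift i
    have hu0 : ¬ Follows E (u 0) (u 1) := hi
    have hu1 : u 1 = (u 0).inv := (hu.rel 0).resolve_left hu0
    obtain ⟨j, hjn, hj⟩ : ∃ j < n, Follows E (u j) (u (j + 1)) := by
      obtain ⟨k, hk⟩ := hex
      refine ⟨(k + i * n - i) % n, Nat.mod_lt _ hs.pos, ?_⟩
      have hle : i ≤ i * n := Nat.le_mul_of_pos_right i hs.pos
      have hk' : s (k + i * n) = s k ∧ s (k + i * n + 1) = s (k + 1) := by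
        rw [← hs.map_mod (k + i * n), ← hs.map_mod (k + i * n + 1), add_right_comm]
        simp [hs.map_mod]
      have h1 : u ((k + i * n - i) % n) = s k := by
        rw [hu.map_mod, ← hk'.1]
        simp only [u]
        congr 1
        omega
      have h2 : u ((k + i * n - i) % n + 1) = s (k + 1) := by
        rw [← hu.map_mod, Nat.mod_add_mod, hu.map_mod, ← hk'.2]
        simp only [u]
        congr 1
        omega
      rw [h1, h2]
      exact hk
    have hj0 : j ≠ 0 := by
      rintro rfl
      exact hu0 hj
    have hn1 : n ≠ 1 := by omega
    have hn2 : n ≠ 2 := by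
      rintro rfl
      obtain rfl : j = 1 := by omega
      have h2 : u (1 + 1) = u 0 := hu.periodic 0
      rw [h2, hu1, Follows, tgt_inv] at hj
      exact lt_irrefl _ hj
    obtain ⟨m, rfl⟩ : ∃ m, n = m + 3 := ⟨n - 3, by omega⟩
    let v : ℕ → Move X := fun k => u (k + 2)
    have hlast : u (m + 2 + 1) = u 0 := by
      have := hu.periodic 0
      rwa [zero_add] at this
    have hp := hu.rel (m + 2)
    rw [hlast] at hp
    have hq := hu.rel 1
    -- the last move is compatible with the first move after the deleted pair
    have hclose : Follows E (u (m + 2)) (u 2) ∨ u 2 = (u (m + 2)).inv := by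
      rcases hq with hq | hq
      · rcases hp with hp | hp
        · left
          rw [hu1, Follows, tgt_inv] at hq
          exact hq.trans hp
        · have : u (m + 2) = u 1 := by rw [hu1, hp, inv_inv]
          rw [this]
          exact Or.inl hq
      · have : u 2 = u 0 := by rw [hq, hu1, inv_inv]
        rw [this]
        exact hp
    have hclose' : j = 1 ∨ j = m + 2 → Follows E (u (m + 2)) (u 2) := by
      rintro (rfl | rfl)
      · rcases hp with hp | hp
        · have := hj
          rw [hu1, Follows, tgt_inv] at this
          exact this.trans hp
        · have : u (m + 2) = u 1 := by rw [hu1, hp, inv_inv]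
          rw [this]
          exact hj
      · rw [hlast] at hj
        rcases hq with hq | hq
        · rw [hu1, Follows, tgt_inv] at hq
          exact hq.trans hj
        · have : u 2 = u 0 := by rw [hq, hu1, inv_inv]
          rw [this]
          exact hj
    have hsum : ∑ k ∈ Finset.range (m + 1), cost g (v k) ≤ 0 := by
      have h1 := hs.sum_shift (cost g) i
      rw [Finset.sum_range_succ', Finset.sum_range_succ'] at h1
      have h2 : cost g (u 1) + cost g (u 0) = 0 := by rw [hu1, cost_inv]; ring
      have h3 : ∑ k ∈ Finset.range (m + 1), cost g (s (i + (k + 1 + 1))) =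
        ∑ k ∈ Finset.range (m + 1), cost g (v k) := rfl
      have h4 : cost g (s (i + (0 + 1))) + cost g (s (i + 0)) = 0 := h2
      linarith
    refine ih (m + 1) (by omega) (fun k => v (k % (m + 1)))
      (IsClosedWalk.of_segment (by omega) (fun k _ => hu.rel (k + 2)) hclose) ?_ ?_
    · rw [IsClosedWalk.sum_segment v]
      exact hsum
    · by_cases hj' : j = 1 ∨ j = m + 2
      · refine ⟨m, ?_⟩
        rw [Nat.mod_self, Nat.mod_eq_of_lt (Nat.lt_succ_self m)]
        exact hclose' hj'
      · refine ⟨j - 2, ?_⟩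
        rw [Nat.mod_eq_of_lt (show j - 2 < m + 1 by omega),
          Nat.mod_eq_of_lt (show j - 2 + 1 < m + 1 by omega)]
        simp only [v]
        rw [show j - 2 + 1 + 2 = j + 1 by omega, show j - 2 + 2 = j by omega]
        exact hj

/-- A negative cycle of the digraph yields a closed walk of cost at most `0`: a descending arc
moves down the interval of its second vertex, any other arc up the interval of its first vertex. -/
theorem exists_closed_walk_of_negative_cycle [Fintype X] (E : EndpointOrder X K) {f : X → ℝ≥0}
    {ε : ℝ} (hg : ∀ x, (f x : ℝ) = g x) (hε : 0 < ε)
    (hε' : ε * (Fintype.card X : ℝ) ^ 2 < 1) (C : (digraphG f ε).Cycle) (hC : C.weight < 0) :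
    ∃ n s, IsClosedWalk (Follows E) n s ∧ ∑ k ∈ Finset.range n, cost g (s k) ≤ 0 := by
  classical
  obtain ⟨δ, hδ0, hδ1, hw, -⟩ := exists_weight_eq hg hε hε' C
  have hsum : (∑ i, arcInt g (C.v i) (C.v (i + 1))) ≤ 0 := by
    by_contra! h
    have : (1 : ℝ) ≤ (∑ i, arcInt g (C.v i) (C.v (i + 1)) : ℤ) := by exact_mod_cast h
    linarith
  let v : ℕ → X := fun k => C.v (Fin.ofNat (C.n + 1) k)
  have hsucc : ∀ k, Fin.ofNat (C.n + 1) (k + 1) = Fin.ofNat (C.n + 1) k + 1 := by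
    intro k
    ext
    simp [Fin.val_add]
  have harc : ∀ k, v (k + 1) < v k ∨ IncompRel (· ≤ ·) (v k) (v (k + 1)) := by
    intro k
    have := C.arc (Fin.ofNat (C.n + 1) k)
    rw [← hsucc] at this
    exact this
  have hup : ∀ k, ¬ v (k + 1) < v k → E.left (v (k + 1)) < E.right (v k) := by
    intro k hk
    have h1 : ¬ v k < v (k + 1) := fun h => ((harc k).resolve_left hk).1 h.le
    rw [E.lt_iff, not_lt] at h1
    exact h1.lt_of_ne (E.left_ne_right _ _)
  let s : ℕ → Move X := fun k => if v (k + 1) < v k then down (v (k + 1)) else up (v k)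
  have hper : ∀ k, v (k + (C.n + 1)) = v k := by
    intro k
    simp only [v]
    congr 1
    ext
    simp
  have hrel : ∀ k, Follows E (s k) (s (k + 1)) ∨
      s k = down (v (k + 1)) ∧ s (k + 1) = up (v (k + 1)) := by
    intro k
    by_cases h1 : v (k + 1) < v k <;> by_cases h2 : v (k + 1 + 1) < v (k + 1) <;>
      simp only [s, h1, h2, if_true, if_false]
    · exact Or.inl ((E.lt_iff _ _).1 h2)
    · simp
    · exact Or.inl (((E.lt_iff _ _).1 h2).trans (hup k h1))
    · exact Or.inl (hup k h1)
  refine exists_closed_walk_of_reversals (C.n + 1) s ⟨by omega, fun k => ?_, fun k => ?_⟩ ?_ ?_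
  · simp only [s, hper, add_right_comm k (C.n + 1) 1]
  · rcases hrel k with h | ⟨h1, h2⟩
    · exact Or.inl h
    · right
      show s (k + 1) = (s k).inv
      rw [h1, h2]
      rfl
  · refine le_trans (le_of_eq ?_) hsum
    rw [← Fin.sum_univ_eq_sum_range (fun k => cost g (s k))]
    refine Finset.sum_congr rfl fun i _ => ?_
    simp only [s, v, arcInt, hsucc, Fin.ofNat_val_eq_self]
    split_ifs <;> rfl
  · -- two successive reversals are impossible
    rcases hrel 0 with h | ⟨-, h⟩
    · exact ⟨0, h⟩
    · rcases hrel 1 with h' | ⟨h', -⟩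
      · exact ⟨1, h'⟩
      · rw [zero_add] at h
        rw [h] at h'
        cases h'

/-- In a shortest closed walk of cost at most `0`, every proper part that can be closed up by a
descent has positive cost. -/
theorem exists_minimal_closed_walk
    (h : ∃ n s, IsClosedWalk (Follows E) n s ∧ ∑ k ∈ Finset.range n, cost g (s k) ≤ 0) :
    ∃ n s, IsClosedWalk (Follows E) n s ∧ ∑ k ∈ Finset.range n, cost g (s k) ≤ 0 ∧
      ∀ i j, i < j → j < i + n → src E (s (i + 1)) < tgt E (s j) →
        ∑ k ∈ Finset.range (i + 1), cost g (s k) < ∑ k ∈ Finset.range (j + 1), cost g (s k) := by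
  classical
  obtain ⟨s, hs, hcost⟩ := Nat.find_spec h
  refine ⟨Nat.find h, s, hs, hcost, fun i j hij hj hlt => ?_⟩
  obtain ⟨m, rfl⟩ := Nat.exists_eq_add_of_lt hij
  by_contra hle
  rw [add_right_comm i m 1, add_assoc (i + 1) m 1, Finset.sum_range_add _ (i + 1)] at hle
  refine Nat.find_min h (m := m + 1) (by omega) ⟨fun k => s (i + 1 + k % (m + 1)), ?_, ?_⟩
  · refine IsClosedWalk.of_segment (s := fun k => s (i + 1 + k)) (by omega)
      (fun k _ => hs.rel (i + 1 + k)) ?_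
    rw [show i + m + 1 = i + 1 + m by ring] at hlt
    exact hlt
  · rw [IsClosedWalk.sum_segment (fun k => s (i + 1 + k))]
    linarith

end Walks

/-! ### Shortest closed walks of cost at most zero -/

section Shortest

variable {X : Type*} {g : X → ℤ} {n : ℕ} {s : ℕ → Move X}

open Move

theorem Move.cost_mem (hg : ∀ x, g x = 1 ∨ g x = 2) (s : Move X) :
    cost g s = 1 ∨ cost g s = 2 ∨ cost g s = -1 ∨ cost g s = -2 := by
  cases s with
  | up x => rcases hg x with h | h <;> simp [cost, h]
  | down x => rcases hg x with h | h <;> simp [cost, h]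

/-- The level reached after the move `s i`, when the move `s 0` starts at level `0`. -/
def level (g : X → ℤ) (s : ℕ → Move X) (i : ℕ) : ℤ := ∑ k ∈ Finset.range (i + 1), cost g (s k)

theorem level_succ (s : ℕ → Move X) (i : ℕ) :
    level g s (i + 1) = level g s i + cost g (s (i + 1)) :=
  Finset.sum_range_succ _ _

theorem IsClosedWalk.level_add {T : Move X → Move X → Prop} (hs : IsClosedWalk T n s) (i : ℕ) :
    level g s (i + n) = level g s i + ∑ k ∈ Finset.range n, cost g (s k) := by
  rw [level, level, add_right_comm, Finset.sum_range_add, hs.sum_shift]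

variable {K : Type*} [PartialOrder X] [LinearOrder K] {E : EndpointOrder X K}

theorem Move.cost_pos_iff (E : EndpointOrder X K) (hg : ∀ x, g x = 1 ∨ g x = 2) (s : Move X) :
    0 < cost g s ↔ src E s < tgt E s := by
  cases s with
  | up x =>
    have := E.left_lt_right x
    rcases hg x with h | h <;> simp [cost, src, tgt, h, this]
  | down x =>
    have := (E.left_lt_right x).le
    rcases hg x with h | h <;> simp [cost, src, tgt, h, this]

theorem Move.cost_neg_iff (E : EndpointOrder X K) (hg : ∀ x, g x = 1 ∨ g x = 2) (s : Move X) :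
    cost g s < 0 ↔ tgt E s < src E s := by
  cases s with
  | up x =>
    have := (E.left_lt_right x).le
    rcases hg x with h | h <;> simp [cost, src, tgt, h, this]
  | down x =>
    have := E.left_lt_right x
    rcases hg x with h | h <;> simp [cost, src, tgt, h, this]

/-- The descents between consecutive moves of a shortest walk are pairwise disjoint, and the cost
of the walk from a lower to a higher one is positive. -/
theorem lt_or_lt_of_minimal (hs : IsClosedWalk (Follows E) n s)
    (hmin : ∀ i j, i < j → j < i + n → src E (s (i + 1)) < tgt E (s j) →
      level g s i < level g s j) {i j : ℕ} (hij : i < j) (hj : j < i + n) :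
    src E (s (i + 1)) < tgt E (s j) ∧ level g s i < level g s j ∨
      src E (s (j + 1)) < tgt E (s i) ∧
        level g s j < level g s i + ∑ k ∈ Finset.range n, cost g (s k) := by
  by_cases h : src E (s (i + 1)) < tgt E (s j)
  · exact Or.inl ⟨h, hmin i j hij hj h⟩
  · right
    have h1 : src E (s (j + 1)) < tgt E (s i) :=
      (hs.rel j).trans_le ((not_lt.1 h).trans (le_of_lt (hs.rel i)))
    refine ⟨h1, ?_⟩
    rw [← hs.level_add]
    refine hmin j (i + n) hj (by omega) ?_
    rw [hs.periodic]
    exact h1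

theorem not_and_of_minimal (hs : IsClosedWalk (Follows E) n s)
    (hcost : ∑ k ∈ Finset.range n, cost g (s k) ≤ 0)
    (hmin : ∀ i j, i < j → j < i + n → src E (s (i + 1)) < tgt E (s j) →
      level g s i < level g s j) {i j : ℕ} (hij : i < j) (hj : j < i + n)
    (h1 : src E (s (i + 1)) < tgt E (s j)) : ¬ src E (s (j + 1)) < tgt E (s i) := by
  intro h2
  have h3 := hmin i j hij hj h1
  have h4 := hmin j (i + n) hj (by omega) (by rw [hs.periodic]; exact h2)
  rw [hs.level_add] at h4
  omega

theorem two_le_of_cost_nonpos (hg : ∀ x, g x = 1 ∨ g x = 2) (hs : IsClosedWalk (Follows E) n s)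
    (hcost : ∑ k ∈ Finset.range n, cost g (s k) ≤ 0) : 2 ≤ n := by
  by_contra hn
  obtain rfl : n = 1 := by have := hs.pos; omega
  have h1 := hs.rel 0
  have h2 : s (0 + 1) = s 0 := hs.periodic 0
  rw [h2, Follows, ← cost_pos_iff E hg] at h1
  simp at hcost
  omega

/-- A shortest walk of negative cost has length `2`. Around its lowest descent, the move that leads
there must have length `2`, and the two neighbouring descents cannot be placed consistently. -/
theorem eq_two_of_cost_neg (hg : ∀ x, g x = 1 ∨ g x = 2) (hs : IsClosedWalk (Follows E) n s)
    (hcost : ∑ k ∈ Finset.range n, cost g (s k) < 0)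
    (hmin : ∀ i j, i < j → j < i + n → src E (s (i + 1)) < tgt E (s j) →
      level g s i < level g s j) : n = 2 := by
  have h2n := two_le_of_cost_nonpos hg hs hcost.le
  by_contra hn
  obtain ⟨i₀, hi₀, hlow⟩ := Finset.exists_min_image (Finset.range n) (fun i => tgt E (s i))
    ⟨0, by simpa using hs.pos⟩
  obtain ⟨i, hi⟩ : ∃ i, i + 1 = i₀ + n := ⟨i₀ + n - 1, by omega⟩
  have hlow' : ∀ j, tgt E (s (i + 1)) ≤ tgt E (s j) := by
    intro j
    rw [hi, hs.periodic, ← hs.map_mod j]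
    exact hlow _ (Finset.mem_range.2 (Nat.mod_lt _ hs.pos))
  have hdown : src E (s (i + 1 + 1)) < tgt E (s i) := (hs.rel (i + 1)).trans_le (hlow' i)
  have hlev : level g s (i + 1) <
      level g s i + ∑ k ∈ Finset.range n, cost g (s k) := by
    rcases lt_or_lt_of_minimal hs hmin (Nat.lt_succ_self i) (by omega) with h | h
    · exact absurd hdown (not_and_of_minimal hs hcost.le hmin (Nat.lt_succ_self i) (by omega) h.1)
    · exact h.2
  have hup : ¬ cost g (s (i + 1 + 1)) < 0 := by
    rw [cost_neg_iff E hg]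
    intro h
    exact absurd (hlow' (i + 1 + 1)) (not_le.2 (h.trans (hs.rel (i + 1))))
  have h1 := level_succ (g := g) s i
  have h2 := level_succ (g := g) s (i + 1)
  have h3 := cost_mem hg (s (i + 1))
  have h4 := cost_mem hg (s (i + 1 + 1))
  rcases lt_or_lt_of_minimal hs hmin (show i < i + 1 + 1 by omega) (by omega) with h | h <;>
    omega

/-- A walk of length `2` consists of an interval and another one nested strictly inside it. -/
theorem exists_nested (hg : ∀ x, g x = 1 ∨ g x = 2) (hs : IsClosedWalk (Follows E) 2 s)
    (hcost : ∑ k ∈ Finset.range 2, cost g (s k) ≤ 0) :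
    ∃ x y, E.left x < E.left y ∧ E.right y < E.right x ∧ g x ≤ g y := by
  have h0 := hs.rel 0
  have h1 := hs.rel 1
  rw [show s (1 + 1) = s 0 from hs.periodic 0] at h1
  rw [Finset.sum_range_succ, Finset.sum_range_one] at hcost
  rw [zero_add] at h0
  cases e0 : s 0 with
  | up x =>
    cases e1 : s 1 with
    | up y =>
      rw [e0, e1] at hcost
      simp only [cost] at hcost
      have := hg x
      have := hg y
      omega
    | down y =>
      rw [e0, e1] at hcost h0 h1
      refine ⟨x, y, h1, h0, ?_⟩
      simp only [cost] at hcost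
      omega
  | down y =>
    cases e1 : s 1 with
    | up x =>
      rw [e0, e1] at hcost h0 h1
      refine ⟨x, y, h0, h1, ?_⟩
      simp only [cost] at hcost
      omega
    | down x =>
      rw [e0, e1] at h0 h1
      have h2 := E.left_lt_right x
      have h3 := E.left_lt_right y
      exact absurd (h0.trans (h3.trans h1)) (lt_asymm h2)

/-- In a shortest walk of cost `0` the levels of the descents reflect their positions. -/
theorem src_lt_tgt_iff_of_minimal (hs : IsClosedWalk (Follows E) n s)
    (hcost : ∑ k ∈ Finset.range n, cost g (s k) = 0)
    (hmin : ∀ i j, i < j → j < i + n → src E (s (i + 1)) < tgt E (s j) →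
      level g s i < level g s j) (i j : ℕ) :
    (src E (s (i + 1)) < tgt E (s j) ↔ level g s i ≤ level g s j) ∧
      (level g s i = level g s j → i % n = j % n) := by
  have hper : Function.Periodic (level g s) n := fun k => by rw [hs.level_add, hcost, add_zero]
  have key : ∀ i j, i % n ≠ j % n → src E (s (i + 1)) < tgt E (s j) →
      level g s i < level g s j := by
    intro i j hne h
    have hi := Nat.mod_lt i hs.pos
    have hj := Nat.mod_lt j hs.pos
    have h1 : s (i % n + 1) = s (i + 1) := by
      rw [← hs.map_mod, Nat.mod_add_mod, hs.map_mod]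
    rw [← hper.map_mod_nat i, ← hper.map_mod_nat j]
    rw [← hs.map_mod j, ← h1] at h
    rcases lt_or_gt_of_ne hne with hlt | hlt
    · exact hmin _ _ hlt (by omega) h
    · rw [← hper (j % n)]
      exact hmin _ _ (by omega) (by omega) (by rwa [hs.periodic])
  by_cases hne : i % n = j % n
  · have h1 : level g s i = level g s j := by
      rw [← hper.map_mod_nat i, hne, hper.map_mod_nat]
    have h2 : s i = s j := by rw [← hs.map_mod i, hne, hs.map_mod]
    simp only [h1, hne, le_refl, iff_true, implies_true, and_true]
    rw [← h2]
    exact hs.rel i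
  · by_cases h : src E (s (i + 1)) < tgt E (s j)
    · have := key i j hne h
      exact ⟨⟨fun _ => this.le, fun _ => h⟩, fun h => absurd h this.ne⟩
    · have : level g s j < level g s i :=
        key j i (Ne.symm hne)
          ((hs.rel j).trans_le ((not_lt.1 h).trans (le_of_lt (hs.rel i))))
      exact ⟨⟨fun h' => absurd h' h, fun h' => absurd h' (not_le.2 this)⟩,
        fun h => absurd h this.ne'⟩

end Shortest

/-! ### Cycles of integers with short steps -/

/-- The relation `S` is the successor relation of a single cycle, of length at least `3`, through
integers between `0` and `M`, both included, with steps of size `1` or `2`. -/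
structure IsLevelCycle (S : ℤ → ℤ → Prop) (M : ℤ) : Prop where
  step : ∀ u v, S u v → v - u = 1 ∨ v - u = 2 ∨ v - u = -1 ∨ v - u = -2
  succ_unique : ∀ u v v', S u v → S u v' → v = v'
  pred_unique : ∀ u u' v, S u v → S u' v → u = u'
  exists_succ : ∀ u v, S u v → ∃ w, S v w
  exists_pred : ∀ u v, S u v → ∃ w, S w u
  not_symm : ∀ u v, S u v → ¬ S v u
  connected : ∀ A : Set ℤ, (∀ u v, S u v → (u ∈ A ↔ v ∈ A)) →
    ∀ u v u' v', S u v → u ∈ A → S u' v' → u' ∈ A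
  mem_Icc : ∀ u v, S u v → 0 ≤ u ∧ u ≤ M
  exists_zero : ∃ v, S 0 v
  exists_max : ∃ v, S M v

namespace IsLevelCycle

variable {S : ℤ → ℤ → Prop} {M : ℤ}

theorem mem_Icc' (h : IsLevelCycle S M) {u v : ℤ} (huv : S u v) : 0 ≤ v ∧ v ≤ M := by
  obtain ⟨w, hw⟩ := h.exists_succ u v huv
  exact h.mem_Icc v w hw

theorem exists_pred_of_succ (h : IsLevelCycle S M) {u : ℤ} (hu : ∃ v, S u v) : ∃ w, S w u := by
  obtain ⟨v, hv⟩ := hu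
  exact h.exists_pred u v hv

theorem flip (h : IsLevelCycle S M) : IsLevelCycle (fun u v => S v u) M where
  step u v huv := by have := h.step v u huv; omega
  succ_unique u v v' := h.pred_unique v v' u
  pred_unique u u' v := h.succ_unique v u u'
  exists_succ u v huv := h.exists_pred v u huv
  exists_pred u v huv := h.exists_succ v u huv
  not_symm u v huv := h.not_symm v u huv
  connected A hA u v u' v' huv hu huv' := by
    have hA' : ∀ u v, S u v → (u ∈ A ↔ v ∈ A) := fun u v huv => (hA v u huv).symm
    exact (hA' v' u' huv').1 (h.connected A hA' v u v' u' huv ((hA' v u huv).2 hu) huv')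
  mem_Icc u v huv := h.mem_Icc' huv
  exists_zero := h.exists_pred_of_succ h.exists_zero
  exists_max := h.exists_pred_of_succ h.exists_max

/-- Two strands of the cycle that run through all levels from `0` to `h` and end at `h` and `h - 1`:
the levels of one parity class are visited in ascending, those of the other in descending order.
The class of `h - 1` is the ascending one. -/
def Strands (S : ℤ → ℤ → Prop) (h : ℤ) : Prop :=
  ∀ k, -1 ≤ k → k ≤ h - 2 →
    (k % 2 = (h - 1) % 2 → S (max k 0) (k + 2)) ∧ (k % 2 ≠ (h - 1) % 2 → S (k + 2) (max k 0))

/-- The strand that ends at `h - 1` must continue to `h + 1`, unless it meets the other strand at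
the maximal level. -/
theorem Strands.next (hS : IsLevelCycle S M) {h : ℤ} (h2 : 2 ≤ h) (hM : h ≤ M)
    (hQ : Strands S h) : S (h - 1) (h + 1) ∨ S (h - 1) h ∧ h = M := by
  have hlast := (hQ (h - 3) (by omega) (by omega)).1 (by omega)
  rw [show h - 3 + 2 = h - 1 by ring] at hlast
  have hother := (hQ (h - 2) (by omega) (by omega)).2 (by omega)
  rw [show h - 2 + 2 = h by ring, max_eq_left (by omega)] at hother
  obtain ⟨v, hv⟩ := hS.exists_succ _ _ hlast
  have hv0 := hS.mem_Icc' hv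
  have hcases : v = h - 3 ∨ v = h - 2 ∨ v = h ∨ v = h + 1 := by
    have := hS.step _ _ hv
    omega
  rcases hcases with rfl | rfl | rfl | rfl
  · rw [max_eq_left (by omega)] at hlast
    exact absurd hv (hS.not_symm _ _ hlast)
  · have := hS.pred_unique _ _ _ hv hother
    omega
  · right
    refine ⟨hv, ?_⟩
    -- the strands have closed up, so that no other level is visited
    have hclosed : ∀ u w, S u w → (u ∈ Set.Icc 0 v ↔ w ∈ Set.Icc 0 v) := by
      intro u w huw
      have hu0 := hS.mem_Icc _ _ huw
      have hw0 := hS.mem_Icc' huw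
      simp only [Set.mem_Icc]
      constructor
      · rintro ⟨-, hu⟩
        refine ⟨hw0.1, ?_⟩
        by_cases hpar : u % 2 = (v - 1) % 2
        · rcases lt_or_ge u (v - 1) with hlt | hge
          · have h1 := (hQ u (by omega) (by omega)).1 hpar
            rw [max_eq_left hu0.1] at h1
            have := hS.succ_unique _ _ _ h1 huw
            omega
          · obtain rfl : u = v - 1 := by omega
            exact (hS.succ_unique _ _ _ hv huw).ge
        · rcases eq_or_ne u 0 with rfl | hne
          · have h1 := (hQ 0 (by omega) (by omega)).1
            have h3 := (hQ (-1) (by omega) (by omega)).1 (by omega)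
            have := hS.succ_unique _ _ _ h3 huw
            omega
          · have h1 := (hQ (u - 2) (by omega) (by omega)).2 (by omega)
            rw [show u - 2 + 2 = u by ring] at h1
            have := hS.succ_unique _ _ _ h1 huw
            omega
      · rintro ⟨-, hw⟩
        refine ⟨hu0.1, ?_⟩
        by_cases hpar : w % 2 = (v - 1) % 2
        · rcases eq_or_ne w 0 with rfl | hne
          · have h3 := (hQ (-1) (by omega) (by omega)).2 (by omega)
            have := hS.pred_unique _ _ _ h3 huw
            omega
          · have h1 := (hQ (w - 2) (by omega) (by omega)).1 (by omega)
            rw [show w - 2 + 2 = w by ring] at h1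
            have := hS.pred_unique _ _ _ h1 huw
            omega
        · rcases lt_or_ge w (v - 1) with hlt | hge
          · have h1 := (hQ w (by omega) (by omega)).2 hpar
            rw [max_eq_left hw0.1] at h1
            have := hS.pred_unique _ _ _ h1 huw
            omega
          · obtain rfl : w = v := by omega
            have := hS.pred_unique _ _ _ hv huw
            omega
    obtain ⟨w, hw⟩ := hS.exists_max
    have := hS.connected _ hclosed _ _ M w hv ⟨by omega, by omega⟩ hw
    exact le_antisymm hM this.2
  · exact Or.inl hv

/-- The cycle zigzags: it ascends through the levels of one parity class and descends through those
of the other; only the steps next to the levels `0` and `M` have size `1`. -/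
theorem exists_parity (hS : IsLevelCycle S M) (hM : 2 ≤ M) :
    ∃ σ : ℤ, (σ = 0 ∨ σ = 1) ∧ ∀ k, -1 ≤ k → k < M →
      (k % 2 = σ → S (max k 0) (min (k + 2) M)) ∧
        (k % 2 ≠ σ → S (min (k + 2) M) (max k 0)) := by
  have hbase : ∃ R : ℤ → ℤ → Prop, (R = S ∨ R = fun u v => S v u) ∧ Strands R 2 := by
    obtain ⟨v, hv⟩ := hS.exists_zero
    obtain ⟨w, hw⟩ := hS.exists_pred_of_succ hS.exists_zero
    have h1 := hS.step _ _ hv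
    have h2 := hS.step _ _ hw
    have h3 := hS.mem_Icc' hv
    have h4 := hS.mem_Icc _ _ hw
    have hne : v ≠ w := by
      rintro rfl
      exact hS.not_symm _ _ hv hw
    have hcases : v = 1 ∧ w = 2 ∨ v = 2 ∧ w = 1 := by omega
    rcases hcases with ⟨rfl, rfl⟩ | ⟨rfl, rfl⟩
    · refine ⟨S, Or.inl rfl, fun k hk hk' => ?_⟩
      obtain rfl | rfl : k = -1 ∨ k = 0 := by omega
      · exact ⟨fun _ => hv, fun h => absurd rfl h⟩
      · exact ⟨fun h => by simp at h, fun _ => hw⟩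
    · refine ⟨fun u v => S v u, Or.inr rfl, fun k hk hk' => ?_⟩
      obtain rfl | rfl : k = -1 ∨ k = 0 := by omega
      · exact ⟨fun _ => hw, fun h => absurd rfl h⟩
      · exact ⟨fun h => by simp at h, fun _ => hv⟩
  have hcycle : ∀ R : ℤ → ℤ → Prop, (R = S ∨ R = fun u v => S v u) → IsLevelCycle R M := by
    rintro R (rfl | rfl)
    · exact hS
    · exact hS.flip
  have hstrands : ∀ h : ℤ, 2 ≤ h → h ≤ M →
      ∃ R : ℤ → ℤ → Prop, (R = S ∨ R = fun u v => S v u) ∧ Strands R h := by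
    intro h h2
    induction h, h2 using Int.leInduction with
    | base => exact fun _ => hbase
    | succ h h2 ih =>
      intro hM'
      obtain ⟨R, hR, hQ⟩ := ih (by omega)
      rcases hQ.next (hcycle R hR) h2 (by omega) with hnext | ⟨-, rfl⟩
      · refine ⟨fun u v => R v u, ?_, fun k hk hk' => ?_⟩
        · rcases hR with rfl | rfl
          · exact Or.inr rfl
          · exact Or.inl rfl
        · rcases (show k = h - 1 ∨ k ≤ h - 2 by omega) with rfl | hk''
          · refine ⟨fun h' => by omega, fun _ => ?_⟩
            rw [max_eq_left (by omega), show h - 1 + 2 = h + 1 by ring]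
            exact hnext
          · have := hQ k hk hk''
            exact ⟨fun h' => this.2 (by omega), fun h' => this.1 (by omega)⟩
      · omega
  obtain ⟨R, hR, hQ⟩ := hstrands M hM le_rfl
  have htop : R (M - 1) M := by
    rcases hQ.next (hcycle R hR) hM le_rfl with h | h
    · have := (hcycle R hR).mem_Icc' h
      omega
    · exact h.1
  have hall : ∀ k, -1 ≤ k → k < M →
      (k % 2 = (M - 1) % 2 → R (max k 0) (min (k + 2) M)) ∧
        (k % 2 ≠ (M - 1) % 2 → R (min (k + 2) M) (max k 0)) := by
    intro k hk hkM
    rcases (show k = M - 1 ∨ k ≤ M - 2 by omega) with rfl | hk'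
    · refine ⟨fun _ => ?_, fun h => absurd rfl h⟩
      rw [max_eq_left (by omega), min_eq_right (by omega)]
      exact htop
    · rw [min_eq_left (by omega)]
      exact hQ k hk hk'
  rcases hR with rfl | rfl
  · exact ⟨(M - 1) % 2, by omega, hall⟩
  · exact ⟨M % 2, by omega, fun k hk hkM =>
      ⟨fun h => (hall k hk hkM).2 (by omega), fun h => (hall k hk hkM).1 (by omega)⟩⟩

end IsLevelCycle

/-! ### Zigzags of intervals -/

/-- Points `z k`, for `-1 ≤ k < M`, that compare like the truncations to `[0, M]` of the intervals
`[k, k + 2]`, and whose weights are the lengths of these truncations. Two intervals that merely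
touch count as disjoint if neither index has the parity of `σ`, and as overlapping otherwise. The
points `upper` and `lower` stand for intervals that touch `[0, M]` from above and from below, with
indices of the parity opposite to `σ`. -/
structure Zigzag (X : Type*) [PartialOrder X] (g : X → ℤ) (M σ : ℤ) where
  z : ℤ → X
  upper : X
  lower : X
  weight_eq : ∀ k, -1 ≤ k → k < M → g (z k) = min (k + 2) M - max k 0
  lt_of_lt : ∀ k l, -1 ≤ k → l < M → k + 2 < l → z k < z l
  not_lt_of_lt : ∀ k l, -1 ≤ k → k < M → -1 ≤ l → l < M → l < k + 2 → ¬ z k < z l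
  lt_add_two_iff : ∀ k, -1 ≤ k → k + 2 < M → (z k < z (k + 2) ↔ k % 2 ≠ σ)
  lower_lt : ∀ k, -1 ≤ k → k < M → 1 ≤ k ∨ k % 2 ≠ σ → lower < z k
  not_lower_lt : ∀ k, -1 ≤ k → k ≤ 0 → k % 2 = σ → ¬ lower < z k
  not_lt_lower : ∀ k, -1 ≤ k → k < M → ¬ z k < lower
  lt_upper : ∀ k, -1 ≤ k → k < M → k + 2 < M ∨ k % 2 ≠ σ → z k < upper
  not_lt_upper : ∀ k, M ≤ k + 2 → k < M → k % 2 = σ → ¬ z k < upper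
  not_upper_lt : ∀ k, -1 ≤ k → k < M → ¬ upper < z k

section Construction

variable {X : Type*} {g : X → ℤ} {n : ℕ} {s : ℕ → Move X}

open Move

/-- The successor relation of the levels of a walk, shifted by `m`. -/
def LevelStep (g : X → ℤ) (s : ℕ → Move X) (m u v : ℤ) : Prop :=
  ∃ i, level g s i = m + u ∧ level g s (i + 1) = m + v

theorem isLevelCycle_levelStep (hg : ∀ x, g x = 1 ∨ g x = 2) {T : Move X → Move X → Prop}
    (hs : IsClosedWalk T n s) (hn : 3 ≤ n)
    (hper : ∀ i, level g s (i + n) = level g s i)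
    (hinj : ∀ i j, level g s i = level g s j → i % n = j % n) {m M : ℤ}
    (hmM : ∀ i, m ≤ level g s i ∧ level g s i ≤ m + M)
    (hm : ∃ i, level g s i = m) (hM : ∃ i, level g s i = m + M) :
    IsLevelCycle (LevelStep g s m) M := by
  have hper' : Function.Periodic (level g s) n := hper
  have hper1 : Function.Periodic (fun i => level g s (i + 1)) n := fun i => by
    simp only [add_right_comm i n 1, hper]
  have hinj' : ∀ i j, level g s i = level g s j → level g s (i + 1) = level g s (j + 1) := by
    intro i j h
    rw [← hper1.map_mod_nat i, hinj i j h, hper1.map_mod_nat]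
  have hpred : ∀ i, ∃ j, level g s (j + 1) = level g s i := by
    intro i
    refine ⟨i + n - 1, ?_⟩
    rw [← hper i]
    congr 1
    omega
  constructor
  · rintro u v ⟨i, hi, hi'⟩
    have h1 := level_succ (g := g) s i
    have h2 := cost_mem hg (s (i + 1))
    omega
  · rintro u v v' ⟨i, hi, hi'⟩ ⟨j, hj, hj'⟩
    have := hinj' i j (by omega)
    omega
  · rintro u u' v ⟨i, hi, hi'⟩ ⟨j, hj, hj'⟩
    have h1 : (i + 1) % n = (j + 1) % n := hinj _ _ (by omega)
    have h2 : i % n = j % n := Nat.ModEq.add_right_cancel' 1 h1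
    have : level g s i = level g s j := by
      rw [← hper'.map_mod_nat i, h2, hper'.map_mod_nat]
    omega
  · rintro u v ⟨i, hi, hi'⟩
    exact ⟨level g s (i + 1 + 1) - m, i + 1, hi', by ring⟩
  · rintro u v ⟨i, hi, hi'⟩
    obtain ⟨j, hj⟩ := hpred i
    exact ⟨level g s j - m, j, by ring, by omega⟩
  · rintro u v ⟨i, hi, hi'⟩ ⟨j, hj, hj'⟩
    have h1 : (i + 1) % n = j % n := hinj _ _ (by omega)
    have h2 : (j + 1) % n = i % n := hinj _ _ (by omega)
    have h3 : i + 2 ≡ i + 0 [MOD n] := (Nat.ModEq.add_right 1 h1).trans h2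
    have h4 := (Nat.modEq_zero_iff_dvd).1 (Nat.ModEq.add_left_cancel' i h3)
    have := Nat.le_of_dvd (by omega) h4
    omega
  · rintro A hA u v u' v' ⟨i, hi, hi'⟩ hu ⟨j, hj, hj'⟩
    have hall : ∀ k, level g s (i + k) - m ∈ A := by
      intro k
      induction k with
      | zero => rwa [add_zero, hi, add_sub_cancel_left]
      | succ k ih =>
        exact (hA _ _ ⟨i + k, by ring, by rw [← add_assoc i k 1]; ring⟩).1 ih
    have h1 := hall (j + i * n - i)
    have hle : i ≤ i * n := Nat.le_mul_of_pos_right i hs.pos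
    rw [show i + (j + i * n - i) = j + i * n by omega,
      show level g s (j + i * n) = level g s j by
        have := hper'.nat_mul i j
        simpa using this, hj] at h1
    simpa using h1
  · rintro u v ⟨i, hi, -⟩
    have := hmM i
    omega
  · obtain ⟨i, hi⟩ := hm
    exact ⟨level g s (i + 1) - m, i, by omega, by ring⟩
  · obtain ⟨i, hi⟩ := hM
    exact ⟨level g s (i + 1) - m, i, hi, by ring⟩

variable {K : Type*} [PartialOrder X] [LinearOrder K] {E : EndpointOrder X K}

/-- If the levels of a closed walk form a zigzag and reflect the positions of the descents, then
all comparabilities between the points of the walk are determined by the levels. The points `a`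
and `b` come from the descents at the highest and at the lowest level. -/
theorem exists_zigzag (hg : ∀ x, g x = 1 ∨ g x = 2) (hs : IsClosedWalk (Follows E) n s)
    (hlev : ∀ i j, src E (s (i + 1)) < tgt E (s j) ↔ level g s i ≤ level g s j)
    (hinj : ∀ i j, level g s i = level g s j → i % n = j % n) {m M σ : ℤ} (hM : 2 ≤ M)
    (hσ : σ = 0 ∨ σ = 1)
    (hS : ∀ k, -1 ≤ k → k < M →
      (k % 2 = σ → LevelStep g s m (max k 0) (min (k + 2) M)) ∧
        (k % 2 ≠ σ → LevelStep g s m (min (k + 2) M) (max k 0))) :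
    Nonempty (Zigzag X g M σ) := by
  -- the position `e` lies within the descent at level `u`
  let At : K → ℤ → Prop := fun e u =>
    ∃ i, level g s i = m + u ∧ src E (s (i + 1)) ≤ e ∧ e ≤ tgt E (s i)
  have hAt : ∀ {e e' u u'}, At e u → At e' u' → u < u' → e ≤ e' := by
    rintro e e' u u' ⟨i, hi, -, he⟩ ⟨j, hj, he', -⟩ hlt
    have h1 : ¬ src E (s (j + 1)) < tgt E (s i) := by
      rw [hlev]
      omega
    exact he.trans ((not_lt.1 h1).trans he')
  have hAtSrc : ∀ {i u}, level g s i = m + u → At (src E (s (i + 1))) u := fun {i u} hi =>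
    ⟨i, hi, le_rfl, (hs.rel i).le⟩
  have hAtTgt : ∀ {i u}, level g s i = m + u → At (tgt E (s i)) u := fun {i u} hi =>
    ⟨i, hi, (hs.rel i).le, le_rfl⟩
  have hmove : ∀ i j, level g s i = level g s j → s i = s j := by
    intro i j h
    rw [← hs.map_mod i, hinj i j h, hs.map_mod]
  have hz : ∀ k, ∃ x, -1 ≤ k → k < M →
      (k % 2 = σ → ∃ i, level g s i = m + max k 0 ∧ level g s (i + 1) = m + min (k + 2) M ∧
        s (i + 1) = up x) ∧
      (k % 2 ≠ σ → ∃ i, level g s i = m + min (k + 2) M ∧ level g s (i + 1) = m + max k 0 ∧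
        s (i + 1) = down x) := by
    intro k
    by_cases hk : -1 ≤ k ∧ k < M
    · by_cases hpar : k % 2 = σ
      · obtain ⟨i, hi, hi'⟩ := (hS k hk.1 hk.2).1 hpar
        cases hx : s (i + 1) with
        | up x => exact ⟨x, fun _ _ => ⟨fun _ => ⟨i, hi, hi', hx⟩, fun h => absurd hpar h⟩⟩
        | down x =>
          have h1 := level_succ (g := g) s i
          rw [hx, cost] at h1
          have := hg x
          omega
      · obtain ⟨i, hi, hi'⟩ := (hS k hk.1 hk.2).2 hpar
        cases hx : s (i + 1) with
        | down x => exact ⟨x, fun _ _ => ⟨fun h => absurd h hpar, fun _ => ⟨i, hi, hi', hx⟩⟩⟩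
        | up x =>
          have h1 := level_succ (g := g) s i
          rw [hx, cost] at h1
          have := hg x
          omega
    · cases s 0 with
      | up x => exact ⟨x, fun h1 h2 => absurd ⟨h1, h2⟩ hk⟩
      | down x => exact ⟨x, fun h1 h2 => absurd ⟨h1, h2⟩ hk⟩
  choose z hz using hz
  have hL : ∀ k, -1 ≤ k → k < M → At (E.left (z k)) (max k 0) := by
    intro k h1 h2
    by_cases hpar : k % 2 = σ
    · obtain ⟨i, hi, hi', hx⟩ := (hz k h1 h2).1 hpar
      have := hAtSrc hi
      rwa [hx] at this
    · obtain ⟨i, hi, hi', hx⟩ := (hz k h1 h2).2 hpar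
      have := hAtTgt hi'
      rwa [hx] at this
  have hR : ∀ k, -1 ≤ k → k < M → At (E.right (z k)) (min (k + 2) M) := by
    intro k h1 h2
    by_cases hpar : k % 2 = σ
    · obtain ⟨i, hi, hi', hx⟩ := (hz k h1 h2).1 hpar
      have := hAtTgt hi'
      rwa [hx] at this
    · obtain ⟨i, hi, hi', hx⟩ := (hz k h1 h2).2 hpar
      have := hAtSrc hi
      rwa [hx] at this
  have hlt : ∀ x y, E.right x ≤ E.left y → x < y := fun x y h =>
    (E.lt_iff x y).2 (h.lt_of_ne (E.left_ne_right y x).symm)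
  have hnlt : ∀ x y, E.left y ≤ E.right x → ¬ x < y := fun x y h h' =>
    absurd ((E.lt_iff x y).1 h') (not_lt.2 h)
  -- the point `b`, from the two moves at the lowest level
  obtain ⟨b, hb, hby, hbx⟩ : ∃ b, At (E.right b) 0 ∧ b < z (σ - 1) ∧ ¬ b < z (-σ) := by
    obtain ⟨i, -, hi, hy⟩ := (hz (σ - 1) (by omega) (by omega)).2 (by omega)
    obtain ⟨j, hj, -, hx⟩ := (hz (-σ) (by omega) (by omega)).1 (by omega)
    rw [max_eq_right (by omega)] at hi hj
    have h1 : s (i + 1) = s j := hmove _ _ (by rw [hi, hj])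
    have h2 := hs.rel j
    rw [← h1, hx, hy] at h2
    obtain ⟨b, hb, hb'⟩ := E.exists_below _ _ h2
    refine ⟨b, ⟨j, hj, ?_, ?_⟩, hb, hb'⟩
    · rw [hx]
      exact not_lt.1 fun h => hb' ((E.lt_iff _ _).2 h)
    · rw [← h1, hy]
      exact ((E.lt_iff _ _).1 hb).le
  -- the point `a`, from the two moves at the highest level
  obtain ⟨a, ha, hya, hxa⟩ : ∃ a, At (E.left a) M ∧ z (M - 1 - (M - σ) % 2) < a ∧
      ¬ z (M - 1 - (M - 1 - σ) % 2) < a := by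
    obtain ⟨i, -, hi, hx⟩ := (hz (M - 1 - (M - 1 - σ) % 2) (by omega) (by omega)).1 (by omega)
    obtain ⟨j, hj, -, hy⟩ := (hz (M - 1 - (M - σ) % 2) (by omega) (by omega)).2 (by omega)
    rw [min_eq_right (by omega)] at hi hj
    have h1 : s (i + 1) = s j := hmove _ _ (by rw [hi, hj])
    have h2 := hs.rel j
    rw [← h1, hx, hy] at h2
    obtain ⟨a, ha, ha'⟩ := E.exists_above _ _ h2
    refine ⟨a, ⟨j, hj, ?_, ?_⟩, ha, ha'⟩
    · rw [hy]
      exact ((E.lt_iff _ _).1 ha).le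
    · rw [← h1, hx]
      exact not_lt.1 fun h => ha' ((E.lt_iff _ _).2 h)
  refine ⟨⟨z, a, b, ?_, ?_, ?_, ?_, ?_, ?_, ?_, ?_, ?_, ?_⟩⟩
  · intro k h1 h2
    by_cases hpar : k % 2 = σ
    · obtain ⟨i, hi, hi', hx⟩ := (hz k h1 h2).1 hpar
      have h3 := level_succ (g := g) s i
      rw [hx, cost] at h3
      omega
    · obtain ⟨i, hi, hi', hx⟩ := (hz k h1 h2).2 hpar
      have h3 := level_succ (g := g) s i
      rw [hx, cost] at h3
      omega
  · intro k l h1 h2 h3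
    exact hlt _ _ (hAt (hR k h1 (by omega)) (hL l (by omega) h2) (by omega))
  · intro k l h1 h2 h3 h4 h5
    exact hnlt _ _ (hAt (hL l h3 h4) (hR k h1 h2) (by omega))
  · intro k h1 h2
    have hρ : min (k + 2) M = max (k + 2) 0 := by omega
    by_cases hpar : k % 2 = σ
    · obtain ⟨i, hi, hi', hx⟩ := (hz k h1 (by omega)).1 hpar
      obtain ⟨j, hj, hj', hy⟩ := (hz (k + 2) (by omega) (by omega)).1 (by omega)
      have h3 := (hlev j (i + 1)).2 (by omega)
      rw [hx, hy] at h3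
      exact iff_of_false (hnlt _ _ h3.le) fun h => h hpar
    · obtain ⟨i, hi, hi', hx⟩ := (hz k h1 (by omega)).2 hpar
      obtain ⟨j, hj, hj', hy⟩ := (hz (k + 2) (by omega) (by omega)).2 (by omega)
      have h3 := (hlev i (j + 1)).2 (by omega)
      rw [hx, hy] at h3
      exact iff_of_true (hlt _ _ h3.le) hpar
  · intro k h1 h2 h3
    by_cases hk : 1 ≤ k
    · exact hlt _ _ (hAt hb (hL k h1 h2) (by omega))
    · obtain rfl : k = σ - 1 := by omega
      exact hby
  · intro k h1 h2 h3
    obtain rfl : k = -σ := by omega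
    exact hbx
  · intro k h1 h2
    exact hnlt _ _ ((E.left_lt_right b).le.trans (hAt hb (hR k h1 h2) (by omega)))
  · intro k h1 h2 h3
    by_cases hk : k + 2 < M
    · exact hlt _ _ (hAt (hR k h1 h2) ha (by omega))
    · obtain rfl : k = M - 1 - (M - σ) % 2 := by omega
      exact hya
  · intro k h1 h2 h3
    obtain rfl : k = M - 1 - (M - 1 - σ) % 2 := by omega
    exact hxa
  · intro k h1 h2
    exact hnlt _ _ ((hAt (hL k h1 h2) ha (by omega)).trans (E.left_lt_right a).le)

end Construction

section Embedding

variable {X : Type*} [PartialOrder X] {f : X → ℝ≥0} {g : X → ℤ} {M σ : ℤ}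

open Family Label

theorem Family.x_mem_ones_iff {j : Family} {t i : ℕ} :
    x i ∈ j.ones t ↔ i = 0 ∧ j.HasX0 ∨ i = t + 1 ∧ j.top t = y (t + 1) := by
  cases j <;> simp [ones, HasX0, top]

theorem Family.y_mem_ones_iff {j : Family} {t i : ℕ} :
    y i ∈ j.ones t ↔ i = 0 ∧ ¬ j.HasX0 ∨ i = t + 1 ∧ j.top t = a := by
  cases j <;> simp [ones, HasX0, top]

/-- The points of a member of one of the families inside a zigzag: `x i` is the point with index
`2 i - 2 + σ` and `y i` the one with index `2 i - 1 + σ`, where `a` has index `M`. -/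
def Zigzag.label (Z : Zigzag X g M σ) : Label → X
  | a => Z.upper
  | b => Z.lower
  | x i => Z.z (2 * i - 2 + σ)
  | y i => if (2 * i - 1 + σ : ℤ) = M then Z.upper else Z.z (2 * i - 1 + σ)

theorem Zigzag.member_isInducedIn (Z : Zigzag X g M σ) (h1 : ∀ x, g x = 1 → f x = 1)
    (h2 : ∀ x, g x = 2 → f x = 2) (hM : 2 ≤ M) (hσ : σ = 0 ∨ σ = 1) {j : Family} {t : ℕ}
    (hj : j.HasX0 ↔ σ = 1)
    (ht : j.top t = a ∧ M = 2 * t + 2 + σ ∨ j.top t = y (t + 1) ∧ M = 2 * t + 1 + σ) :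
    (j.member t (f Z.upper) (f Z.lower)).IsInducedIn f := by
  have hx : ∀ {i : ℕ}, x i ∈ j.points t → i ≤ t + 1 ∧ -1 ≤ 2 * (i : ℤ) - 2 + σ ∧
      2 * (i : ℤ) - 2 + σ < M ∧ (2 * (i : ℤ) - 2 + σ) % 2 = σ := by
    intro i hi
    obtain ⟨hi, hi'⟩ := x_mem_points_iff.1 hi
    rw [hj] at hi'
    omega
  have hy : ∀ {i : ℕ}, y i ∈ j.points t → i ≤ t + 1 ∧ -1 ≤ 2 * (i : ℤ) - 1 + σ ∧
      2 * (i : ℤ) - 1 + σ ≤ M ∧ (2 * (i : ℤ) - 1 + σ) % 2 ≠ σ := by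
    intro i hi
    have := y_mem_points_iff.1 hi
    omega
  have ha : a ∈ j.points t → M = 2 * t + 2 + σ := by
    intro h
    rw [a_mem_points_iff] at h
    rcases ht with ht | ht
    · exact ht.2
    · rw [ht.1] at h
      cases h
  have hba : Z.lower < Z.upper :=
    (Z.lower_lt (σ - 1) (by omega) (by omega) (by omega)).trans
      (Z.lt_upper (σ - 1) (by omega) (by omega) (by omega))
  refine Family.member_isInducedIn Z.label ?_ ?_ ?_
  · intro p hp q hq h
    cases h with
    | b_y =>
      have := hy hq
      simp only [Zigzag.label]
      split_ifs with h
      · exact hba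
      · exact Z.lower_lt _ (by omega) (by omega) (by omega)
    | y_y i =>
      have h3 := hy hp
      have h4 := hy hq
      push_cast at h4
      simp only [Zigzag.label]
      rw [if_neg (by omega)]
      split_ifs with h
      · exact Z.lt_upper _ (by omega) (by omega) (by omega)
      · push_cast at h
        have h5 := (Z.lt_add_two_iff (2 * i - 1 + σ) (by omega) (by omega)).2 h3.2.2.2
        convert h5 using 2
        push_cast
        ring
    | x_x i =>
      have h3 := hx hp
      have h4 := hx hq
      push_cast at h4
      simp only [Zigzag.label]
      exact Z.lt_of_lt _ _ (by omega) (by push_cast; omega) (by push_cast; omega)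
    | x_y i =>
      have h3 := hx hp
      have h4 := hy hq
      push_cast at h4
      simp only [Zigzag.label]
      split_ifs with h
      · exact Z.lt_upper _ (by omega) (by omega) (by push_cast at h; omega)
      · push_cast at h
        exact Z.lt_of_lt _ _ (by omega) (by push_cast; omega) (by push_cast; omega)
    | y_x i =>
      have h3 := hy hp
      have h4 := hx hq
      push_cast at h4
      simp only [Zigzag.label]
      rw [if_neg (by omega)]
      exact Z.lt_of_lt _ _ (by omega) (by push_cast; omega) (by push_cast; omega)
    | y_a h =>
      have h3 := hy hp
      have h4 := ha hq
      simp only [Zigzag.label]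
      rw [if_neg (by push_cast; omega)]
      exact Z.lt_upper _ (by omega) (by push_cast; omega) (Or.inr h3.2.2.2)
    | b_x h =>
      have h3 := hx hq
      have h4 : σ = 1 := by
        rw [← hj]
        rcases h with rfl | rfl <;> trivial
      simp only [Zigzag.label]
      exact Z.lower_lt _ (by omega) (by omega) (by push_cast; omega)
  · intro p hp q hq
    contrapose
    intro h
    cases p with
    | a =>
      cases q with
      | a => exact lt_irrefl _
      | b => exact lt_asymm hba
      | x k =>
        have := hx hq
        exact Z.not_upper_lt _ (by omega) (by omega)
      | y k =>
        have := hy hq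
        simp only [Zigzag.label]
        split_ifs with h'
        · exact lt_irrefl _
        · exact Z.not_upper_lt _ (by omega) (by omega)
    | b =>
      cases q with
      | a => exact absurd trivial h
      | b => exact lt_irrefl _
      | x k =>
        have := hx hq
        simp only [Below, hj] at h
        exact Z.not_lower_lt _ (by omega) (by omega) (by omega)
      | y k => exact absurd trivial h
    | x i =>
      have h3 := hx hp
      cases q with
      | a =>
        have h4 := ha hq
        simp only [Below] at h
        exact Z.not_lt_upper _ (by omega) (by omega) (by omega)
      | b => exact Z.not_lt_lower _ (by omega) (by omega)
      | x k =>
        have h4 := hx hq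
        simp only [Below] at h
        rcases eq_or_ne k (i + 1) with rfl | hne
        · have h5 := Z.lt_add_two_iff (2 * i - 2 + σ) (by omega) (by omega)
          rw [show 2 * (i : ℤ) - 2 + σ + 2 = 2 * (i + 1 : ℕ) - 2 + σ by push_cast; ring] at h5
          exact fun h6 => h5.1 h6 h3.2.2.2
        · exact Z.not_lt_of_lt _ _ (by omega) (by omega) (by omega) (by omega) (by omega)
      | y k =>
        have h4 := hy hq
        simp only [Below] at h
        simp only [Zigzag.label]
        split_ifs with h'
        · exact Z.not_lt_upper _ (by omega) (by omega) (by omega)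
        · exact Z.not_lt_of_lt _ _ (by omega) (by omega) (by omega) (by omega) (by omega)
    | y i =>
      have h3 := hy hp
      cases q with
      | a => exact absurd trivial h
      | b =>
        simp only [Zigzag.label]
        split_ifs with h'
        · exact lt_asymm hba
        · exact Z.not_lt_lower _ (by omega) (by omega)
      | x k =>
        have h4 := hx hq
        simp only [Below] at h
        simp only [Zigzag.label]
        split_ifs with h'
        · exact Z.not_upper_lt _ (by omega) (by omega)
        · exact Z.not_lt_of_lt _ _ (by omega) (by omega) (by omega) (by omega) (by omega)
      | y k =>
        have h4 := hy hq
        simp only [Below] at h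
        simp only [Zigzag.label]
        split_ifs with h' h'' h''
        · exact lt_irrefl _
        · exact Z.not_upper_lt _ (by omega) (by omega)
        · omega
        · exact Z.not_lt_of_lt _ _ (by omega) (by omega) (by omega) (by omega) (by omega)
  · rintro ⟨p, hp⟩
    have htop : Z.label (j.top t) = Z.upper := by
      rcases ht with ⟨h, -⟩ | ⟨h, hM'⟩
      · rw [h]
        rfl
      · rw [h, Zigzag.label, if_pos (by push_cast; omega)]
    have hne : ∀ {i : ℕ}, y i ∈ j.points t → y i ≠ j.top t → 2 * (i : ℤ) - 1 + σ < M := by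
      intro i hi hne
      have h6 := hy hi
      rcases ht with ⟨-, h8⟩ | ⟨h7, h8⟩
      · omega
      · have : i ≠ t + 1 := fun h => hne (by rw [h, h7])
        omega
    simp only [Family.member]
    split_ifs with h3 h4 h5
    · rw [h3, htop]
    · rw [h4]
      rfl
    · refine h1 _ ?_
      cases p with
      | a => exact absurd (a_mem_points_iff.1 hp).symm h3
      | b => exact absurd rfl h4
      | x i =>
        have h6 := hx hp
        rw [x_mem_ones_iff, hj] at h5
        rw [Zigzag.label, Z.weight_eq _ h6.2.1 h6.2.2.1]
        rcases ht with ⟨h7, h8⟩ | ⟨h7, h8⟩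
        · simp only [h7, reduceCtorEq, and_false, or_false] at h5
          omega
        · omega
      | y i =>
        have h6 := hy hp
        have hi := hne hp h3
        rw [y_mem_ones_iff, hj] at h5
        rw [Zigzag.label, if_neg hi.ne, Z.weight_eq _ h6.2.1 hi]
        rcases ht with ⟨h7, h8⟩ | ⟨h7, h8⟩
        · omega
        · simp only [h7, reduceCtorEq, and_false, or_false] at h5
          omega
    · refine h2 _ ?_
      cases p with
      | a => exact absurd (a_mem_points_iff.1 hp).symm h3
      | b => exact absurd rfl h4
      | x i =>
        have h6 := hx hp
        rw [x_mem_ones_iff, hj] at h5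
        rw [Zigzag.label, Z.weight_eq _ h6.2.1 h6.2.2.1]
        rcases ht with ⟨h7, h8⟩ | ⟨h7, h8⟩
        · omega
        · simp only [h7, and_true] at h5
          omega
      | y i =>
        have h6 := hy hp
        have hi := hne hp h3
        rw [y_mem_ones_iff, hj] at h5
        rw [Zigzag.label, if_neg hi.ne, Z.weight_eq _ h6.2.1 hi]
        rcases ht with ⟨h7, h8⟩ | ⟨h7, h8⟩
        · simp only [h7, and_true] at h5
          omega
        · omega

end Embedding

/-! ### Forbidden posets from negative cycles -/

section Forbidden

variable {X : Type*} [PartialOrder X] {f : X → ℝ≥0} {g : X → ℤ}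

open Family Move

/-- Every zigzag contains a forbidden poset; the family is determined by the two parities. -/
theorem Zigzag.exists_forbidden {M σ : ℤ} (Z : Zigzag X g M σ) (hf : ∀ x, f x = 1 ∨ f x = 2)
    (h1 : ∀ x, g x = 1 → f x = 1) (h2 : ∀ x, g x = 2 → f x = 2) (hM : 2 ≤ M)
    (hσ : σ = 0 ∨ σ = 1) : ∃ Q ∈ forbidden, Q.IsInducedIn f := by
  obtain ⟨j, t, hj, ht⟩ : ∃ (j : Family) (t : ℕ), (j.HasX0 ↔ σ = 1) ∧
      (j.top t = Label.a ∧ M = 2 * t + 2 + σ ∨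
        j.top t = Label.y (t + 1) ∧ M = 2 * t + 1 + σ) := by
    obtain ⟨t, ht⟩ : ∃ t : ℕ, (t : ℤ) = (M - 1 - σ) / 2 := ⟨((M - 1 - σ) / 2).toNat, by omega⟩
    rcases hσ with rfl | rfl
    · by_cases hpar : M % 2 = 0
      · exact ⟨F1, t, by simp [HasX0], Or.inl ⟨rfl, by omega⟩⟩
      · exact ⟨F2, t, by simp [HasX0], Or.inr ⟨rfl, by omega⟩⟩
    · by_cases hpar : M % 2 = 1
      · exact ⟨F3, t, by simp [HasX0], Or.inl ⟨rfl, by omega⟩⟩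
      · exact ⟨F4, t, by simp [HasX0], Or.inr ⟨rfl, by omega⟩⟩
  exact ⟨_, Or.inr ⟨j, t, _, _, hf _, hf _, rfl⟩, Z.member_isInducedIn h1 h2 hM hσ hj ht⟩

/-- A closed walk of cost at most `0` leads to a forbidden poset: a shortest such walk consists of
two nested intervals or forms a zigzag. -/
theorem exists_forbidden_of_closed_walk {K : Type*} [LinearOrder K] (E : EndpointOrder X K)
    (hf : ∀ x, f x = 1 ∨ f x = 2) (hg : ∀ x, g x = 1 ∨ g x = 2) (h1 : ∀ x, g x = 1 → f x = 1)
    (h2 : ∀ x, g x = 2 → f x = 2)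
    (h : ∃ n s, IsClosedWalk (Follows E) n s ∧ ∑ k ∈ Finset.range n, cost g (s k) ≤ 0) :
    ∃ Q ∈ forbidden, Q.IsInducedIn f := by
  obtain ⟨n, s, hs, hcost, hmin⟩ := exists_minimal_closed_walk h
  have hn := two_le_of_cost_nonpos hg hs hcost
  by_cases hn2 : n = 2
  · subst hn2
    obtain ⟨x, y, hl, hr, hxy⟩ := exists_nested hg hs hcost
    obtain ⟨a, hya, hxa⟩ := E.exists_above x y hr
    obtain ⟨b, hby, hbx⟩ := E.exists_below y x hl
    refine ⟨_, Or.inl ⟨_, ?_, ?_, rfl⟩, threePlusOne_isInducedIn (f := f) hby hya hbx hxa⟩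
    · rintro (i | i)
      · fin_cases i <;> exact hf _
      · exact hf _
    · show f y = 2 ∨ f x = 1
      rcases hg x with hx | hx
      · exact Or.inr (h1 x hx)
      · exact Or.inl (h2 y (by have := hg y; omega))
  · have hcost0 : ∑ k ∈ Finset.range n, cost g (s k) = 0 := by
      by_contra hne
      exact hn2 (eq_two_of_cost_neg hg hs (lt_of_le_of_ne hcost hne) hmin)
    have hlev := src_lt_tgt_iff_of_minimal hs hcost0 hmin
    have hper : ∀ i, level g s (i + n) = level g s i := fun i => by
      rw [hs.level_add, hcost0, add_zero]
    have hper' : Function.Periodic (level g s) n := hper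
    have hinj := fun i j => (hlev i j).2
    have hne : (Finset.range n).Nonempty := ⟨0, Finset.mem_range.2 hs.pos⟩
    obtain ⟨i₀, -, hi₀⟩ := Finset.exists_min_image _ (level g s) hne
    obtain ⟨i₁, -, hi₁⟩ := Finset.exists_max_image _ (level g s) hne
    have hbd : ∀ i, level g s i₀ ≤ level g s i ∧ level g s i ≤ level g s i₁ := by
      intro i
      rw [← hper'.map_mod_nat i]
      have hi := Finset.mem_range.2 (Nat.mod_lt i hs.pos)
      exact ⟨hi₀ _ hi, hi₁ _ hi⟩
    have hM : 2 ≤ level g s i₁ - level g s i₀ := by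
      -- there are at least three different levels
      have hne' : ∀ i j, i < 3 → j < 3 → i ≠ j → level g s i ≠ level g s j := by
        intro i j hi hj hij h
        have := hinj i j h
        rw [Nat.mod_eq_of_lt (by omega), Nat.mod_eq_of_lt (by omega)] at this
        exact hij this
      have h01 := hne' 0 1 (by omega) (by omega) (by omega)
      have h02 := hne' 0 2 (by omega) (by omega) (by omega)
      have h12 := hne' 1 2 (by omega) (by omega) (by omega)
      have h0 := hbd 0
      have h1 := hbd 1
      have h2 := hbd 2
      omega
    have hcycle := isLevelCycle_levelStep hg hs (by omega) hper hinj
      (m := level g s i₀) (M := level g s i₁ - level g s i₀)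
      (fun i => by have := hbd i; omega) ⟨i₀, rfl⟩ ⟨i₁, by omega⟩
    obtain ⟨σ, hσ, hS⟩ := hcycle.exists_parity hM
    obtain ⟨Z⟩ := exists_zigzag hg hs (fun i j => (hlev i j).1) hinj hM hσ hS
    exact Z.exists_forbidden hf h1 h2 hM hσ

end Forbidden

end WeightedIntervalOrder

open WeightedIntervalOrder in
theorem mainTheorem2 {X : Type*} [Fintype X] [PartialOrder X] (hP : IsIntervalOrder X)
    (f : X → ℝ≥0) (hf : ∀ x, f x = 1 ∨ f x = 2)
    (ε : ℝ) (hε : 0 < ε) (hε' : ε * (Fintype.card X : ℝ) ^ 2 < 1) :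
    List.TFAE [
      ∃ I : X → NonemptyInterval ℝ, IsIntervalRepresentation I ∧ ∀ x, (I x).length = (f x : ℝ),
      ¬ ∃ C : (digraphG f ε).Cycle, C.weight < 0,
      ∀ Q ∈ forbidden, ¬ Q.IsInducedIn f] := by
  classical
  have hex : ∀ x, ∃ c : ℤ, (f x : ℝ) = c ∧ (c = 1 ∨ c = 2) ∧ (c = 1 → f x = 1) ∧
      (c = 2 → f x = 2) := by
    intro x
    rcases hf x with h | h
    · exact ⟨1, by simp [h], Or.inl rfl, fun _ => h, fun h => by omega⟩
    · exact ⟨2, by simp [h], Or.inr rfl, fun h => by omega, fun _ => h⟩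
  choose g hfg hg h1 h2 using hex
  tfae_have 1 → 2 := by
    rintro ⟨I, hI, hlen⟩
    exact not_exists_negative_cycle hfg hε hε' hI hlen
  tfae_have 2 → 1 := by
    intro h
    obtain ⟨p, hp⟩ := WeightedDigraph.exists_potential (G := digraphG f ε)
      fun C => not_lt.1 fun hC => h ⟨C, hC⟩
    exact exists_representation_of_potential hε hp
  tfae_have 1 → 3 := by
    rintro ⟨I, hI, hlen⟩
    exact not_isInducedIn_of_representation hI hlen
  tfae_have 3 → 2 := by
    rintro h ⟨C, hC⟩
    obtain ⟨E⟩ := hP.nonempty_endpointOrder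
    obtain ⟨Q, hQ, hQ'⟩ := exists_forbidden_of_closed_walk E hf hg h1 h2
      (exists_closed_walk_of_negative_cycle E hfg hε hε' C hC)
    exact h Q hQ hQ'
  tfae_finish
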